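/- **Setting.** All logarithms are to base 2. $\mathbb S$ is a finite, linearly ordered set of semantic states (ground atoms) with a fixed ground Horn proof system, i.e. a set of rules "from a finite set of premises infer a conclusion". $\mathrm{Cn}(\Gamma)$ is the set of states derivable from $\Gamma\subseteq\mathbb S$; $T(\Gamma)$ is $\Gamma$ together with the states derivable from $\Gamma$ in one step; $T^\delta$ is the $\delta$-fold iterate. Let $S_O\subseteq\mathbb S$ be a knowledge base, $P_O$ a probability distribution on $S_O$, and $\hat S_O\subseteq\mathbb S$ a nonempty reconstruction alphabet. The core $A=\mathrm{Atom}(S_O)$ is what remains of $S_O$ when its elements are scanned in increasing order and $s$ is deleted whenever it is derivable from the other elements that are still present. $\mathsf D_d=\max_{q\in S_O}\min\{n:q\in T^n(A)\}$ is the maximum derivation depth. For $\delta\in\mathbb N$, $$A_\delta=\mathrm{Atom}_\delta(S_O)=\{s\in S_O: s\notin T^\delta(S_O\setminus\{s\})\}.$$ For $B\subseteq S_O$ put $P_B=P_O(B)$, $\pi_B=P_O(\cdot\mid B)$, with $P_BH(\pi_B)=0$ if $P_B=0$; write $P_\delta,\pi_\delta$ for $B=A_\delta$. The $\delta$-constrained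 closure distortion $d^\delta(s,\hat s)$ is $0$ if $S_O\subseteq T^\delta((S_O\setminus\{s\})\cup\{\hat s\})$ and $1$ otherwise; the closure distortion $d_{\mathrm{Cn}}(s,\hat s)$ is the Jaccard distance of $\mathrm{Cn}(S_O)$ and $\mathrm{Cn}((S_O\setminus\{s\})\cup\{\hat s\})$. *Core-disjointness*: the sets $\{\hat s\in\hat S_O:d_{\mathrm{Cn}}(a,\hat s)=0\}$, $a\in A$, are pairwise disjoint. *$\delta$-core-disjointness*: the sets $\{\hat s\in\hat S_O:d^\delta(a,\hat s)=0\}$, $a\in A_\delta$, are pairwise disjoint. $W:S_C\rightsquigarrow\hat S_C$ is a discrete memoryless channel with finite alphabets and Shannon capacity $C(W)>0$. *$\delta$-constrained closure-reliable communication* of $(S_O,P_O)$ over $W$ is possible if there are codes $f_m:S_O^m\to S_C^m$, $g_m:\hat S_C^m\to\hat S_O^m$ $(m\in\mathbb N)$, using one channel use per source letter, such that for an i.i.d. source of law $P_O$ the expected per-letter distortion $\mathbb E\bigl[\frac1m\sum_{t=1}^m d^\delta(S_t,\hat S_t)\bigr]$ tends to $0$ as $m\to\infty$. Let $$\delta^*=\min\{\delta\ge0:\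 P_\delta H(\pi_\delta)\le C(W)\}$$ whenever this feasible set is nonempty. For $0<\varepsilon<1$ let $n^*_\varepsilon(\delta)$ be the least $n$ for which there are $f:S_O\to S_C^n$ and $g:\hat S_C^n\to\hat S_O$ with $\max_{s\in S_O}\Pr[d^\delta(s,g(Y^n))>0\mid f(s)\text{ sent through }W^{\otimes n}]\le\varepsilon$. **Theorem (Semantic sampling theorem).** *Minimum delay.* For every $\delta\in\mathbb N$ with $A_\delta\subseteq\hat S_O$ for which $\delta$-core-disjointness holds, $\delta$-constrained closure-reliable communication is possible if and only if $P_\delta H(\pi_\delta)\le C(W)$. Consequently, if $S_O\subseteq\hat S_O$, core-disjointness holds, $\delta$-core-disjointness holds for all $0\le\delta\le\mathsf D_d$, and the feasible set is nonempty, then $\delta^*$ is the least $\delta\in\mathbb N$ for which $\delta$-constrained closure-reliable communication is possible. (i) If $H(P_O)\le C(W)$, then the feasible set is nonempty and $\delta^*=0$; if moreover $S_O\subseteq\hat S_O$, then $0$-constrained closure-reliable communication is possible. (ii) If $A\subseteq\hat S_O$, core-disjointness holds and $P_AH(\pi_A)>C(W)$, then the feasible set is empty, and $\delta$-constrained closure-reliable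 communication is impossible for every $\delta\in\mathbb N$ with $A_\delta\subseteq\hat S_O$ for which $\delta$-core-disjointness holds. (iii) If $H(P_O)>C(W)$ and $P_AH(\pi_A)\le C(W)$, then the feasible set is nonempty and $1\le\delta^*\le\mathsf D_d$. If moreover $\mathrm{Atom}_{\delta^*}(S_O)\subseteq\hat S_O$ and $\delta^*$-core-disjointness holds, then the minimum blocklength at delay $\delta^*$ is about $\log|\mathrm{Atom}_{\delta^*}(S_O)|/C(W)$ in the following sense: for every $0<\varepsilon<1$, $n^*_\varepsilon(\delta^*)$ exists, $$n^*_\varepsilon(\delta^*)\ \ge\ \frac{(1-\varepsilon)\log|\mathrm{Atom}_{\delta^*}(S_O)|-1}{C(W)},$$ and for every $\eta>0$ $$n^*_\varepsilon(\delta^*)\ \le\ (1+\eta)\,\frac{\log|\mathrm{Atom}_{\delta^*}(S_O)|}{C(W)}\qquad\text{whenever }|\mathrm{Atom}_{\delta^*}(S_O)|\ge K(\varepsilon,\eta),$$ where the threshold $K(\varepsilon,\eta)$ depends only on $W,\varepsilon,\eta$ and not on the knowledge base. -/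

import Mathlib

open Filter Topology

namespace SemComm

/-! ### Ground Horn proof systems over a finite universe -/

/-- A ground Horn rule: from all the `premises` infer the `conclusion`. -/
structure HornRule (U : Type*) where
  premises : Finset U
  conclusion : U

/-- Single-step derivability `Γ ⊢¹ s` in the proof system with rule set `R`. -/
def DerivesInOne {U : Type*} (R : Set (HornRule U)) (Γ : Set U) (s : U) : Prop :=
  ∃ r ∈ R, (∀ p ∈ r.premises, p ∈ Γ) ∧ r.conclusion = s

/-- Derivability `Γ ⊢ s`: there is a finite proof tree with leaves in `Γ`. -/
inductive Derives {U : Type*} (R : Set (HornRule U)) (Γ : Set U) : U → Prop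
  | prem (s : U) (h : s ∈ Γ) : Derives R Γ s
  | rule (r : HornRule U) (hr : r ∈ R) (h : ∀ p ∈ r.premises, Derives R Γ p) :
      Derives R Γ r.conclusion

/-- The deductive closure. -/
def Cn {U : Type*} (R : Set (HornRule U)) (Γ : Set U) : Set U :=
  {s | Derives R Γ s}

/-- The immediate consequence operator; `(T R)^[n]` is its `n`-fold iterate. -/
def T {U : Type*} (R : Set (HornRule U)) (Γ : Set U) : Set U :=
  Γ ∪ {s | DerivesInOne R Γ s}

theorem subset_T {U : Type*} (R : Set (HornRule U)) (Γ : Set U) : Γ ⊆ T R Γ :=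
  Set.subset_union_left

theorem iterate_T_mono {U : Type*} (R : Set (HornRule U)) (Γ : Set U) :
    Monotone (fun n => (T R)^[n] Γ) := by
  refine monotone_nat_of_le_succ fun n => ?_
  simp only [Function.iterate_succ_apply']
  exact subset_T R _

/-- The deductive closure is the union of the iterates of the immediate consequence operator. -/
theorem Cn_eq_iUnion {U : Type*} (R : Set (HornRule U)) (Γ : Set U) :
    Cn R Γ = ⋃ n, (T R)^[n] Γ := by
  ext s
  simp only [Set.mem_iUnion]
  constructor
  · intro h
    induction h with
    | prem s h => exact ⟨0, h⟩
    | rule r hr _ ih =>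
      choose! k hk using ih
      refine ⟨r.premises.sup k + 1, ?_⟩
      rw [Function.iterate_succ_apply']
      exact Or.inr ⟨r, hr, fun p hp => iterate_T_mono R Γ (Finset.le_sup hp) (hk p hp), rfl⟩
  · rintro ⟨n, hn⟩
    induction n generalizing s with
    | zero => exact Derives.prem s hn
    | succ n ih =>
      rw [Function.iterate_succ_apply'] at hn
      rcases hn with hn | ⟨r, hr, hp, rfl⟩
      · exact ih s hn
      · exact Derives.rule r hr fun p h => ih p (hp p h)

/-- Derivation depth: the least `n` with `s ∈ Tⁿ(B)`, and `∞` if there is none. -/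
noncomputable def depth {U : Type*} (R : Set (HornRule U)) (B : Set U) (s : U) : ℕ∞ :=
  sInf ((fun n : ℕ => (n : ℕ∞)) '' {n : ℕ | s ∈ (T R)^[n] B})

open Classical in
/-- The irredundant core: scan the elements of `S` in increasing (canonical) order and delete
`s` from the current set whenever `s` is derivable from the other elements of that set. -/
noncomputable def atom {U : Type*} [LinearOrder U] (R : Set (HornRule U)) (S : Finset U) :
    Finset U :=
  (S.sort (· ≤ ·)).foldl
    (fun A s => if s ∈ Cn R ((A : Set U) \ {s}) then A.erase s else A) S

/-- The maximum intrinsic derivation depth (`0` for the empty base). -/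
noncomputable def maxDepth {U : Type*} [LinearOrder U] (R : Set (HornRule U)) (S : Finset U) :
    ℕ∞ :=
  S.sup (fun q => depth R (atom R S : Set U) q)

open Classical in
/-- The `δ`-irredundant core. -/
noncomputable def atomDelta {U : Type*} (R : Set (HornRule U)) (S : Finset U) (δ : ℕ) :
    Finset U :=
  S.filter (fun s => s ∉ (T R)^[δ] ((S : Set U) \ {s}))

/-! ### Distortions -/

/-- Closure distortion relative to the base `S`: the Jaccard distance of the two closures.
The union of the closures contains `s`, so the denominator is positive on a finite universe. -/
noncomputable def closureDist {U : Type*} (R : Set (HornRule U)) (S : Finset U) (s t : U) : ℝ :=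
  1 - ((Cn R (((S : Set U) \ {s}) ∪ {s}) ∩ Cn R (((S : Set U) \ {s}) ∪ {t})).ncard : ℝ) /
    ((Cn R (((S : Set U) \ {s}) ∪ {s}) ∪ Cn R (((S : Set U) \ {s}) ∪ {t})).ncard : ℝ)

open Classical in
/-- `δ`-constrained closure distortion relative to the base `S`. -/
noncomputable def deltaDist {U : Type*} (R : Set (HornRule U)) (S : Finset U) (δ : ℕ) (s t : U) :
    ℝ :=
  if (S : Set U) ⊆ (T R)^[δ] (((S : Set U) \ {s}) ∪ {t}) then 0 else 1

/-- Deductive independence of the core, for the reconstruction alphabet `Shat`. -/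
def CoreDisjoint {U : Type*} [LinearOrder U] (R : Set (HornRule U)) (S Shat : Finset U) : Prop :=
  ∀ a₁ ∈ atom R S, ∀ a₂ ∈ atom R S, a₁ ≠ a₂ →
    Disjoint {t : U | t ∈ Shat ∧ closureDist R S a₁ t = 0}
      {t : U | t ∈ Shat ∧ closureDist R S a₂ t = 0}

/-- Deductive independence of the `δ`-irredundant core, for the alphabet `Shat`. -/
def DeltaCoreDisjoint {U : Type*} (R : Set (HornRule U)) (S Shat : Finset U) (δ : ℕ) : Prop :=
  ∀ a₁ ∈ atomDelta R S δ, ∀ a₂ ∈ atomDelta R S δ, a₁ ≠ a₂ →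
    Disjoint {t : U | t ∈ Shat ∧ deltaDist R S δ a₁ t = 0}
      {t : U | t ∈ Shat ∧ deltaDist R S δ a₂ t = 0}

/-! ### Entropy, mutual information, capacity (in bits) -/

/-- Shannon entropy in bits, with `0 log 0 = 0`. -/
noncomputable def entropy {α : Type*} [Fintype α] (p : α → ℝ) : ℝ :=
  ∑ x, Real.negMulLog (p x) / Real.log 2

/-- Mutual information in bits between the input (law `p`) and the output of the kernel `W`;
the terms with `p x * W x y = 0` vanish. -/
noncomputable def mutualInfo {X Y : Type*} [Fintype X] [Fintype Y] (p : X → ℝ) (W : X → Y → ℝ) :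
    ℝ :=
  ∑ x, ∑ y, p x * W x y * Real.logb 2 (W x y / ∑ x', p x' * W x' y)

/-- Markov kernels between finite types. -/
def IsKernel {X Y : Type*} [Fintype Y] (W : X → Y → ℝ) : Prop :=
  ∀ x, W x ∈ stdSimplex ℝ Y

/-- Shannon capacity: the supremum (for a kernel, a maximum) of the mutual information over all
input laws. -/
noncomputable def capacity {X Y : Type*} [Fintype X] [Fintype Y] (W : X → Y → ℝ) : ℝ :=
  sSup ((fun p : X → ℝ => mutualInfo p W) '' stdSimplex ℝ X)

/-- The `n`-fold memoryless extension of `W`. -/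
def memoryless {X Y : Type*} (W : X → Y → ℝ) {n : ℕ} (x : Fin n → X) (y : Fin n → Y) : ℝ :=
  ∏ i, W (x i) (y i)

/-! ### The rate `P_δ H(π_δ)` and the delay threshold -/

/-- `P_O(B)`. -/
def mass {U : Type*} [DecidableEq U] {S : Finset U} (P : S → ℝ) (B : Finset U) : ℝ :=
  ∑ s : S, if (s : U) ∈ B then P s else 0

/-- The conditional law `P_O(· ∣ B)`, extended by `0` outside `B`. -/
noncomputable def condLaw {U : Type*} [DecidableEq U] {S : Finset U} (P : S → ℝ) (B : Finset U) :
    S → ℝ :=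
  fun s => if (s : U) ∈ B then P s / mass P B else 0

/-- `P_B H(π_B)`; it is `0` if `P_B = 0`. -/
noncomputable def subsetRate {U : Type*} [DecidableEq U] {S : Finset U} (P : S → ℝ)
    (B : Finset U) : ℝ :=
  mass P B * entropy (condLaw P B)

/-- The delays `δ` with `P_δ H(π_δ) ≤ C(W)`. -/
def feasibleDelays {U X Y : Type*} [LinearOrder U] [Fintype X] [Fintype Y]
    (R : Set (HornRule U)) {S : Finset U} (P : S → ℝ) (W : X → Y → ℝ) : Set ℕ :=
  {δ | subsetRate P (atomDelta R S δ) ≤ capacity W}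

/-- `δ*`, the minimum of the feasible delays (meaningful only if there is one). -/
noncomputable def minDelay {U X Y : Type*} [LinearOrder U] [Fintype X] [Fintype Y]
    (R : Set (HornRule U)) {S : Finset U} (P : S → ℝ) (W : X → Y → ℝ) : ℕ :=
  sInf (feasibleDelays R P W)

/-! ### Block transmission of an i.i.d. source -/

/-- Expected per-letter `δ`-constrained closure distortion when `m` i.i.d. source letters of law
`P` are sent with encoder `f` over `n` uses of `W` and reconstructed by the decoder `g`. -/
noncomputable def expectedDist {U X Y : Type*} [Fintype Y]
    (R : Set (HornRule U)) {S Shat : Finset U} (P : S → ℝ) (W : X → Y → ℝ) (δ : ℕ) {m n : ℕ}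
    (f : (Fin m → S) → Fin n → X) (g : (Fin n → Y) → Fin m → Shat) : ℝ :=
  ∑ s : Fin m → S, (∏ i, P (s i)) *
    ∑ y : Fin n → Y, memoryless W (f s) y * ((m : ℝ)⁻¹ * ∑ i, deltaDist R S δ (s i) (g y i))

/-- `δ`-constrained closure-reliable communication of the source `(S, P)` over `W`, at one channel
use per source letter: some sequence of codes has vanishing expected distortion. -/
def ReliableAtDelay {U X Y : Type*} [Fintype Y]
    (R : Set (HornRule U)) {S : Finset U} (Shat : Finset U) (P : S → ℝ) (W : X → Y → ℝ)
    (δ : ℕ) : Prop :=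
  ∃ (f : ∀ m : ℕ, (Fin m → S) → Fin m → X) (g : ∀ m : ℕ, (Fin m → Y) → Fin m → Shat),
    Tendsto (fun m => expectedDist R P W δ (f m) (g m)) atTop (𝓝 0)

/-! ### Single-message block codes -/

open Classical in
/-- Maximal `δ`-constrained closure error probability, over all messages in `S`, of the
`(n, |S|)` semantic block code with encoder `f` and decoder `g`. -/
noncomputable def maxError {U X Y : Type*} [Fintype Y]
    (R : Set (HornRule U)) {S Shat : Finset U} (W : X → Y → ℝ) (δ : ℕ) {n : ℕ}
    (f : S → Fin n → X) (g : (Fin n → Y) → Shat) : ℝ :=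
  ⨆ m : S, ∑ y : Fin n → Y, if 0 < deltaDist R S δ m (g y) then memoryless W (f m) y else 0

/-- The blocklengths at which some `(n, |S|)` semantic block code has error at most `ε`. -/
def blocklengths {U X Y : Type*} [Fintype Y]
    (R : Set (HornRule U)) (S Shat : Finset U) (W : X → Y → ℝ) (δ : ℕ) (ε : ℝ) : Set ℕ :=
  {n | ∃ (f : S → Fin n → X) (g : (Fin n → Y) → Shat), maxError R W δ f g ≤ ε}

end SemComm

namespace SemComm


/-! ### Finite product laws -/

/-! A letter outside `atomDelta R S δ` can be re-derived from the rest of the base within `δ` steps,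
so every reconstruction of it has distortion zero. Under δ-core-disjointness one reconstruction
symbol serves at most one letter of that set. At vanishing distortion the source therefore costs
exactly the information needed to name its letters in `atomDelta R S δ`, namely `subsetRate` bits
per letter, and the first claim is a source-channel coding theorem for this rate.

Both converses come from one inequality, `sum_log_le_capacity`: measured against a
capacity-achieving output law, no input word of length `n` has divergence above `n` times the
capacity (`exists_outputLaw`). Well-chosen likelihood functions turn it into the block converse
`subsetRate_le_capacity_of_reliable` and into the Fano bound `logb_card_le_of_code`. The direct part
joins a greedy covering of source blocks (`exists_covering`) to a channel code from Feinstein's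
lemma (`exists_channel_code`). A small share of letters is abandoned, so that equality of rate and
capacity is allowed.

The claims on delays follow since `subsetRate` is monotone in the set: at delay zero the set is `S`,
of rate H(P); from the maximal depth on it lies inside the core (`atomDelta_subset_atom`); under
core-disjointness it always contains a core of at least two atoms (`atom_subset_atomDelta`). For
blocklengths, only the messages in `atomDelta R S δ` need to be told apart. -/

theorem sum_pi_prod {ι α : Type*} [Fintype ι] [Fintype α] [DecidableEq ι] (f : ι → α → ℝ) :
    ∑ s : ι → α, ∏ i, f i (s i) = ∏ i, ∑ a, f i a :=
  (Fintype.prod_sum f).symm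

theorem sum_pi_prod_eq_one {ι α : Type*} [Fintype ι] [Fintype α] [DecidableEq ι] {v : ι → α → ℝ}
    (hv : ∀ i, ∑ a, v i a = 1) : ∑ s : ι → α, ∏ i, v i (s i) = 1 := by
  rw [sum_pi_prod]
  exact Finset.prod_eq_one fun i _ => hv i

/-- Marginalization of a product law to one coordinate. -/
theorem sum_pi_prod_mul {ι α : Type*} [Fintype ι] [Fintype α] [DecidableEq ι] {v : ι → α → ℝ}
    (hv : ∀ i, ∑ a, v i a = 1) (j : ι) (f : α → ℝ) :
    ∑ s : ι → α, (∏ i, v i (s i)) * f (s j) = ∑ a, v j a * f a := by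
  have h : ∀ s : ι → α, (∏ i, v i (s i)) * f (s j) =
      ∏ i, v i (s i) * (if i = j then f (s i) else 1) := by
    intro s
    rw [Finset.prod_mul_distrib, Finset.prod_ite_eq' Finset.univ j]
    simp
  simp_rw [h]
  rw [sum_pi_prod (fun i a => v i a * (if i = j then f a else 1)),
    Finset.prod_eq_single j]
  · simp
  · intro i _ hi
    simp [hi, hv i]
  · simp

theorem sum_pi_prod_mul_sum {ι α : Type*} [Fintype ι] [Fintype α] [DecidableEq ι] {v : ι → α → ℝ}
    (hv : ∀ i, ∑ a, v i a = 1) (f : ι → α → ℝ) :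
    ∑ s : ι → α, (∏ i, v i (s i)) * ∑ i, f i (s i) = ∑ i, ∑ a, v i a * f i a := by
  simp_rw [Finset.mul_sum]
  rw [Finset.sum_comm]
  exact Finset.sum_congr rfl fun j _ => sum_pi_prod_mul hv j (f j)

theorem exists_le_of_le_sum_mul {α : Type*} [Fintype α] {p v : α → ℝ} {c : ℝ}
    (hp : p ∈ stdSimplex ℝ α) (h : c ≤ ∑ a, p a * v a) : ∃ a, c ≤ v a := by
  by_contra! hlt
  have hle : ∀ a ∈ Finset.univ, 0 ≤ p a * (c - v a) := fun a _ =>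
    mul_nonneg (hp.1 a) (sub_nonneg.2 (hlt a).le)
  have hsum : ∑ a, p a * (c - v a) = 0 := by
    refine le_antisymm ?_ (Finset.sum_nonneg hle)
    simp_rw [mul_sub, Finset.sum_sub_distrib, ← Finset.sum_mul, hp.2]
    linarith
  have h0 : ∀ a, p a = 0 := fun a => by
    have := (Finset.sum_eq_zero_iff_of_nonneg hle).1 hsum a (Finset.mem_univ a)
    exact (mul_eq_zero.1 this).resolve_right (sub_pos.2 (hlt a)).ne'
  have := hp.2
  simp [h0] at this

/-- A Chernoff bound: a sum of i.i.d. variables of negative mean is nonnegative with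
exponentially small probability. -/
theorem exists_prob_sum_nonneg_le {α : Type*} [Fintype α] {w g : α → ℝ}
    (hw : w ∈ stdSimplex ℝ α) (hg : ∑ a, w a * g a < 0) :
    ∃ ρ : ℝ, 0 ≤ ρ ∧ ρ < 1 ∧ ∀ (n : ℕ) (E : (Fin n → α) → Prop) [DecidablePred E],
      (∀ s, E s → (∀ i, w (s i) ≠ 0) → 0 ≤ ∑ i, g (s i)) →
      ∑ s : Fin n → α, (if E s then ∏ i, w (s i) else 0) ≤ ρ ^ n := by
  -- The moment generating function equals 1 at 0 and has slope the negative mean, so it is below 1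
  -- at some `θ > 0`; that value is `ρ`.
  have hd : HasDerivAt (fun θ : ℝ => ∑ a, w a * Real.exp (θ * g a)) (∑ a, w a * g a) 0 := by
    have : ∀ a ∈ Finset.univ, HasDerivAt (fun θ : ℝ => w a * Real.exp (θ * g a)) (w a * g a) 0 := by
      intro a _
      have h1 : HasDerivAt (fun θ : ℝ => θ * g a) (g a) 0 := by
        simpa using (hasDerivAt_id (0 : ℝ)).mul_const (g a)
      simpa using (h1.exp).const_mul (w a)
    simpa using HasDerivAt.fun_sum this
  have hslope := hd.tendsto_slope_zero_right
  have hev := (hslope.eventually (gt_mem_nhds hg)).and self_mem_nhdsWithin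
  obtain ⟨θ, h1, hθ⟩ := hev.exists
  have hθ : 0 < θ := hθ
  have hlt : ∑ a, w a * Real.exp (θ * g a) < 1 := by
    simp only [zero_add, zero_mul, Real.exp_zero, mul_one, hw.2, smul_eq_mul] at h1
    have := (mul_neg_iff.1 h1)
    rcases this with ⟨_, h⟩ | ⟨h, _⟩
    · linarith
    · exact absurd (inv_pos.2 hθ) (not_lt.2 h.le)
  refine ⟨_, Finset.sum_nonneg fun a _ => mul_nonneg (hw.1 a) (Real.exp_pos _).le, hlt, ?_⟩
  intro n E _ hE
  have hprod : (∑ a, w a * Real.exp (θ * g a)) ^ n =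
      ∑ s : Fin n → α, ∏ i, w (s i) * Real.exp (θ * g (s i)) := by
    rw [sum_pi_prod (fun _ a => w a * Real.exp (θ * g a))]
    simp
  rw [hprod]
  refine Finset.sum_le_sum fun s _ => ?_
  split_ifs with h
  · rw [Finset.prod_mul_distrib, ← Real.exp_sum, ← Finset.mul_sum]
    -- Words of weight zero are exempt from the sign condition: in the applications the logarithms
    -- in `g` carry no meaning there.
    by_cases h0 : ∀ i, w (s i) ≠ 0
    · refine le_mul_of_one_le_right (Finset.prod_nonneg fun i _ => hw.1 _) ?_
      exact Real.one_le_exp (mul_nonneg hθ.le (hE s h h0))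
    · push Not at h0
      obtain ⟨i, hi⟩ := h0
      rw [Finset.prod_eq_zero (Finset.mem_univ i) hi]
      simp
  · exact Finset.prod_nonneg fun i _ => mul_nonneg (hw.1 _) (Real.exp_pos _).le

/-! ### Channel coding -/

/-- Feinstein's maximal code lemma. -/
theorem exists_code_of_threshold {X Y : Type*} [Fintype X] [Fintype Y] {V : X → Y → ℝ}
    (hV : IsKernel V) {p : X → ℝ} (hp : p ∈ stdSimplex ℝ X) {θ ε : ℝ} (hθ : 0 < θ)
    (B : X → Y → Prop) [∀ x, DecidablePred (B x)]
    (hB : ∀ x y, B x y → θ * ∑ x', p x' * V x' y ≤ V x y) (M : ℕ)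
    (hM : M / θ + ∑ x, p x * ∑ y, (if B x y then 0 else V x y) ≤ ε) :
    ∃ (c : ℕ → X) (g : Y → ℕ), (∀ j < M, ∀ y, g y = j → B (c j) y) ∧
      ∀ j < M, 1 - ε ≤ ∑ y, if g y = j then V (c j) y else 0 := by
  induction M with
  | zero =>
    obtain ⟨x, -⟩ := exists_le_of_le_sum_mul (v := 0) (c := 0) hp (by simp)
    exact ⟨fun _ => x, fun _ => 0, by simp, by simp⟩
  | succ M ih =>
    have hM' : (M : ℝ) / θ ≤ ((M + 1 : ℕ) : ℝ) / θ := by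
      gcongr
      simp
    obtain ⟨c, g, hgB, hg⟩ := ih (by linarith)
    -- Each decoding region lies where the likelihood is at least `θ` times the output law, so its
    -- output probability is at most `1 / θ`.
    have hmass : ∑ y, (if g y < M then ∑ x, p x * V x y else 0) ≤ M / θ := by
      have h1 : ∀ y, (if g y < M then ∑ x, p x * V x y else 0) =
          ∑ j ∈ Finset.range M, if g y = j then ∑ x, p x * V x y else 0 := by
        intro y
        rw [Finset.sum_ite_eq]
        simp
      simp_rw [h1]
      rw [Finset.sum_comm]
      have h2 : ∀ j ∈ Finset.range M, ∑ y, (if g y = j then ∑ x, p x * V x y else 0) ≤ 1 / θ := by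
        intro j hj
        rw [← (hV (c j)).2, Finset.sum_div]
        refine Finset.sum_le_sum fun y _ => ?_
        split_ifs with h
        · rw [le_div_iff₀ hθ, mul_comm]
          exact hB _ _ (hgB j (Finset.mem_range.1 hj) y h)
        · exact div_nonneg ((hV _).1 _) hθ.le
      refine (Finset.sum_le_sum h2).trans ?_
      simp [div_eq_mul_inv]
    have hav : 1 - ε ≤ ∑ x, p x * ∑ y, (if B x y ∧ ¬ g y < M then V x y else 0) := by
      have h1 : ∀ x, 1 - ∑ y, (if B x y then 0 else V x y) - ∑ y, (if g y < M then V x y else 0) ≤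
          ∑ y, (if B x y ∧ ¬ g y < M then V x y else 0) := by
        intro x
        rw [← (hV x).2, ← Finset.sum_sub_distrib, ← Finset.sum_sub_distrib]
        refine Finset.sum_le_sum fun y _ => ?_
        have := (hV x).1 y
        by_cases hb : B x y <;> by_cases hc : g y < M <;> simp [hb, hc, this]
      have h2 := Finset.sum_le_sum fun x (_ : x ∈ Finset.univ) =>
        mul_le_mul_of_nonneg_left (h1 x) (hp.1 x)
      refine le_trans ?_ h2
      simp_rw [mul_sub, Finset.sum_sub_distrib, mul_one, hp.2]
      have h3 : ∑ x, p x * ∑ y, (if g y < M then V x y else 0) =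
          ∑ y, (if g y < M then ∑ x, p x * V x y else 0) := by
        simp_rw [Finset.mul_sum]
        rw [Finset.sum_comm]
        refine Finset.sum_congr rfl fun y _ => ?_
        split_ifs <;> simp
      rw [h3]
      linarith
    obtain ⟨x, hx⟩ := exists_le_of_le_sum_mul hp hav
    -- The new word is decoded on its acceptance region minus the earlier regions; the value `M + 1`
    -- means that no message is declared.
    refine ⟨fun j => if j < M then c j else x,
      fun y => if g y < M then g y else if B x y then M else M + 1, ?_, ?_⟩
    · intro j hj y hy
      by_cases h : g y < M
      · simp only [h, if_true] at hy
        subst hy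
        simpa [h] using hgB _ h y rfl
      · by_cases hb : B x y
        · simp only [h, if_false, hb, if_true] at hy
          subst hy
          simpa using hb
        · simp only [h, if_false, hb] at hy
          omega
    · intro j hj
      rcases Nat.lt_succ_iff_lt_or_eq.1 hj with h | rfl
      · refine (hg j h).trans (Finset.sum_le_sum fun y _ => ?_)
        simp only [h, if_true]
        by_cases hy : g y = j
        · simp [hy, h]
        · rw [if_neg hy]
          split_ifs <;> first | exact (hV _).1 _ | exact le_rfl
      · refine hx.trans (Finset.sum_le_sum fun y _ => ?_)
        simp only [lt_irrefl, if_false]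
        by_cases hc : g y < j
        · simp [hc, hc.ne]
        · by_cases hb : B x y <;> simp [hc, hb]

theorem memoryless_isKernel {X Y : Type*} [Fintype Y] {W : X → Y → ℝ} (hW : IsKernel W) (n : ℕ) :
    IsKernel (memoryless W : (Fin n → X) → (Fin n → Y) → ℝ) := fun x =>
  ⟨fun y => Finset.prod_nonneg fun i _ => (hW (x i)).1 (y i),
    sum_pi_prod_eq_one (v := fun i => W (x i)) fun i => (hW (x i)).2⟩

theorem exists_mutualInfo_gt {X Y : Type*} [Fintype X] [Fintype Y] {W : X → Y → ℝ} {r : ℝ}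
    (hr0 : 0 ≤ r) (hr : r < capacity W) : ∃ p ∈ stdSimplex ℝ X, r < mutualInfo p W := by
  -- With no input letters the supremum is over the empty set and has the default value 0, which `0
  -- ≤ r < capacity W` rules out.
  have hne : ((fun p : X → ℝ => mutualInfo p W) '' stdSimplex ℝ X).Nonempty := by
    by_contra h
    rw [Set.not_nonempty_iff_eq_empty] at h
    rw [capacity, h, Real.sSup_empty] at hr
    linarith
  obtain ⟨_, ⟨p, hp, rfl⟩, h⟩ := exists_lt_of_lt_csSup hne hr
  exact ⟨p, hp, h⟩

/-- The direct part of the channel coding theorem, for the maximal error probability. -/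
theorem exists_channel_code {X Y : Type*} [Fintype X] [Fintype Y] {W : X → Y → ℝ}
    (hW : IsKernel W) {r ε : ℝ} (hr0 : 0 ≤ r) (hr : r < capacity W) (hε : 0 < ε) :
    ∀ᶠ n : ℕ in atTop, ∀ M : ℕ, (M : ℝ) ≤ 2 ^ (n * r) →
      ∃ (c : ℕ → Fin n → X) (g : (Fin n → Y) → ℕ),
        ∀ j < M, ∑ y, (if g y = j then 0 else memoryless W (c j) y) ≤ ε := by
  classical
  obtain ⟨p, hp, hI⟩ := exists_mutualInfo_gt hr0 hr
  -- The acceptance threshold is `2 ^ (n * r')`: the gap from `r` to `r'` makes `M / θ` vanish, and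
  -- the gap from `r'` to the mutual information makes the information density exceed the threshold
  -- with high probability.
  obtain ⟨r', hrr', hr'I⟩ := exists_between hI
  set q : Y → ℝ := fun y => ∑ x, p x * W x y with hq
  have hw : (fun z : X × Y => p z.1 * W z.1 z.2) ∈ stdSimplex ℝ (X × Y) := by
    refine ⟨fun z => mul_nonneg (hp.1 _) ((hW _).1 _), ?_⟩
    rw [Fintype.sum_prod_type]
    simp_rw [← Finset.mul_sum, (hW _).2, mul_one, hp.2]
  have hg : ∑ z : X × Y, (p z.1 * W z.1 z.2) * (r' - Real.logb 2 (W z.1 z.2 / q z.2)) < 0 := by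
    simp_rw [mul_sub, Finset.sum_sub_distrib, ← Finset.sum_mul, hw.2]
    rw [Fintype.sum_prod_type]
    have : mutualInfo p W = ∑ x, ∑ y, p x * W x y * Real.logb 2 (W x y / q y) := rfl
    linarith
  obtain ⟨ρ, hρ0, hρ1, hρ⟩ := exists_prob_sum_nonneg_le hw hg
  have hlim : Tendsto (fun n : ℕ => ((2 : ℝ) ^ (r - r')) ^ n + ρ ^ n) atTop (𝓝 (0 + 0)) := by
    refine (tendsto_pow_atTop_nhds_zero_of_lt_one (by positivity) ?_).add
      (tendsto_pow_atTop_nhds_zero_of_lt_one hρ0 hρ1)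
    exact Real.rpow_lt_one_of_one_lt_of_neg (by norm_num) (by linarith)
  rw [add_zero] at hlim
  filter_upwards [hlim.eventually (gt_mem_nhds hε)] with n hn M hM
  have hθ : (0 : ℝ) < 2 ^ (n * r') := by positivity
  have hqn : ∀ y : Fin n → Y, ∑ x : Fin n → X, (∏ i, p (x i)) * memoryless W x y =
      ∏ i, q (y i) := by
    intro y
    simp_rw [memoryless, ← Finset.prod_mul_distrib]
    exact sum_pi_prod fun i x => p x * W x (y i)
  have hpn : (fun x : Fin n → X => ∏ i, p (x i)) ∈ stdSimplex ℝ (Fin n → X) :=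
    ⟨fun x => Finset.prod_nonneg fun i _ => hp.1 _, sum_pi_prod_eq_one fun _ => hp.2⟩
  have hbad : ∑ x : Fin n → X, (∏ i, p (x i)) * ∑ y : Fin n → Y,
      (if (2 : ℝ) ^ (n * r') * ∏ i, q (y i) ≤ memoryless W x y then 0 else memoryless W x y) ≤
      ρ ^ n := by
    refine le_trans (le_of_eq ?_) (hρ n (fun z => ¬ (2 : ℝ) ^ (n * r') * ∏ i, q (z i).2 ≤
      memoryless W (fun i => (z i).1) (fun i => (z i).2)) ?_)
    · rw [← (Equiv.arrowProdEquivProdArrow (Fin n) (fun _ => X) (fun _ => Y)).symm.sum_comp,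
        Fintype.sum_prod_type]
      refine Finset.sum_congr rfl fun x _ => ?_
      rw [Finset.mul_sum]
      refine Finset.sum_congr rfl fun y _ => ?_
      by_cases h : (2 : ℝ) ^ (n * r') * ∏ i, q (y i) ≤ memoryless W x y
      · rw [if_pos h, mul_zero]
        exact (if_neg (not_not.2 h)).symm
      · rw [if_neg h]
        refine Eq.trans ?_ (if_pos h).symm
        exact Finset.prod_mul_distrib.symm
    · intro z hz hpos
      have hW0 : ∀ i, 0 < W (z i).1 (z i).2 := fun i =>
        ((hW _).1 _).lt_of_ne' (right_ne_zero_of_mul (hpos i))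
      have hq0 : ∀ i, 0 < q (z i).2 := fun i => by
        refine lt_of_lt_of_le ((hw.1 (z i)).lt_of_ne' (hpos i)) ?_
        exact Finset.single_le_sum (f := fun x => p x * W x (z i).2)
          (fun x _ => mul_nonneg (hp.1 x) ((hW x).1 _)) (Finset.mem_univ (z i).1)
      have hlt := not_le.1 hz
      rw [memoryless, ← div_lt_iff₀ (Finset.prod_pos fun i _ => hq0 i),
        ← Finset.prod_div_distrib] at hlt
      have := Real.logb_lt_logb (b := 2) (by norm_num)
        (Finset.prod_pos fun i _ => div_pos (hW0 i) (hq0 i)) hlt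
      rw [Real.logb_rpow (by norm_num) (by norm_num),
        Real.logb_prod _ _ (fun i _ => (div_pos (hW0 i) (hq0 i)).ne')] at this
      rw [Finset.sum_sub_distrib]
      simp only [Finset.sum_const, Finset.card_univ, Fintype.card_fin, nsmul_eq_mul]
      linarith
  obtain ⟨c, g, -, h⟩ := exists_code_of_threshold (memoryless_isKernel hW n) hpn hθ
    (fun x y => (2 : ℝ) ^ (n * r') * ∏ i, q (y i) ≤ memoryless W x y)
    (fun x y h => by rwa [hqn]) M (ε := ε) (by
      refine le_trans (add_le_add ?_ hbad) hn.le
      rw [div_le_iff₀ hθ, ← Real.rpow_natCast, ← Real.rpow_mul (by norm_num),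
        ← Real.rpow_add (by norm_num)]
      exact hM.trans (le_of_eq (by congr 1; ring)))
  refine ⟨c, g, fun j hj => ?_⟩
  have h1 := (memoryless_isKernel hW n (c j)).2
  have h2 : ∑ y, (if g y = j then 0 else memoryless W (c j) y) +
      ∑ y, (if g y = j then memoryless W (c j) y else 0) = 1 := by
    rw [← Finset.sum_add_distrib, ← h1]
    refine Finset.sum_congr rfl fun y _ => ?_
    split_ifs <;> simp
  linarith [h j hj]


/-! ### The capacity-achieving output law -/

theorem sum_mul_mem_stdSimplex {X Y : Type*} [Fintype X] [Fintype Y] {W : X → Y → ℝ}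
    (hW : IsKernel W) {p : X → ℝ} (hp : p ∈ stdSimplex ℝ X) :
    (fun y => ∑ x, p x * W x y) ∈ stdSimplex ℝ Y := by
  refine ⟨fun y => Finset.sum_nonneg fun x _ => mul_nonneg (hp.1 x) ((hW x).1 y), ?_⟩
  rw [Finset.sum_comm]
  simp_rw [← Finset.mul_sum, (hW _).2, mul_one, hp.2]

/-- A linear term plus the output entropy: continuity in `p` is now evident, and perturbing `p`
affects the linear term explicitly. -/
theorem mutualInfo_mul_log_two {X Y : Type*} [Fintype X] [Fintype Y] {W : X → Y → ℝ}
    (hW : IsKernel W) {p : X → ℝ} (hp : p ∈ stdSimplex ℝ X) :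
    mutualInfo p W * Real.log 2 = ∑ x, p x * ∑ y, W x y * Real.log (W x y) +
      ∑ y, Real.negMulLog (∑ x, p x * W x y) := by
  have h2 : Real.log 2 ≠ 0 := (Real.log_pos (by norm_num)).ne'
  have h1 : ∑ y, Real.negMulLog (∑ x, p x * W x y) =
      ∑ x, ∑ y, -(p x * W x y * Real.log (∑ x', p x' * W x' y)) := by
    rw [Finset.sum_comm]
    refine Finset.sum_congr rfl fun y _ => ?_
    rw [Real.negMulLog, Finset.sum_neg_distrib, ← Finset.sum_mul, neg_mul]
  rw [h1, ← Finset.sum_add_distrib, mutualInfo, Finset.sum_mul]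
  refine Finset.sum_congr rfl fun x _ => ?_
  rw [Finset.sum_mul, Finset.mul_sum, ← Finset.sum_add_distrib]
  refine Finset.sum_congr rfl fun y _ => ?_
  rw [Real.logb, mul_assoc (p x * W x y), div_mul_cancel₀ _ h2]
  by_cases h : p x * W x y = 0
  · rw [← mul_assoc, h]
    simp
  · have hq : 0 < ∑ x', p x' * W x' y :=
      ((mul_nonneg (hp.1 x) ((hW x).1 y)).lt_of_ne' h).trans_le
        (Finset.single_le_sum (f := fun x' => p x' * W x' y)
          (fun x' _ => mul_nonneg (hp.1 x') ((hW x').1 y)) (Finset.mem_univ x))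
    rw [Real.log_div (right_ne_zero_of_mul h) hq.ne']
    ring

theorem continuous_mutualInfo_aux {X Y : Type*} [Fintype X] [Fintype Y] (W : X → Y → ℝ) :
    Continuous fun p : X → ℝ => ∑ x, p x * ∑ y, W x y * Real.log (W x y) +
      ∑ y, Real.negMulLog (∑ x, p x * W x y) := by
  have := Real.continuous_negMulLog
  fun_prop

theorem exists_isMaxOn_mutualInfo {X Y : Type*} [Fintype X] [Fintype Y] {W : X → Y → ℝ}
    (hW : IsKernel W) (hC : 0 < capacity W) :
    ∃ p ∈ stdSimplex ℝ X, mutualInfo p W = capacity W ∧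
      ∀ p' ∈ stdSimplex ℝ X, mutualInfo p' W ≤ mutualInfo p W := by
  obtain ⟨p₀, hp₀, -⟩ := exists_mutualInfo_gt le_rfl hC
  have h2 : 0 < Real.log 2 := Real.log_pos (by norm_num)
  obtain ⟨p, hp, hmax⟩ := (isCompact_stdSimplex ℝ X).exists_isMaxOn ⟨p₀, hp₀⟩
    (continuous_mutualInfo_aux W).continuousOn
  have hle : ∀ p' ∈ stdSimplex ℝ X, mutualInfo p' W ≤ mutualInfo p W := by
    intro p' hp'
    have := isMaxOn_iff.1 hmax p' hp'
    rw [← mutualInfo_mul_log_two hW hp, ← mutualInfo_mul_log_two hW hp'] at this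
    exact le_of_mul_le_mul_right this h2
  refine ⟨p, hp, ?_, hle⟩
  have hg : IsGreatest ((fun p : X → ℝ => mutualInfo p W) '' stdSimplex ℝ X) (mutualInfo p W) :=
    ⟨⟨p, hp, rfl⟩, by rintro _ ⟨p', hp', rfl⟩; exact hle p' hp'⟩
  exact hg.csSup_eq.symm

/-- Gibbs' inequality. -/
theorem sum_mul_log_le_sum_mul_log {Y : Type*} [Fintype Y] {p q : Y → ℝ}
    (hp : p ∈ stdSimplex ℝ Y) (hq : q ∈ stdSimplex ℝ Y) (hpq : ∀ y, 0 < p y → 0 < q y) :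
    ∑ y, p y * Real.log (q y) ≤ ∑ y, p y * Real.log (p y) := by
  have h : ∀ y ∈ Finset.univ, p y * Real.log (q y) - p y * Real.log (p y) ≤ q y - p y := by
    intro y _
    rcases (hp.1 y).eq_or_lt with h0 | h0
    · simp [← h0, hq.1 y]
    · rw [← mul_sub, ← Real.log_div (hpq y h0).ne' h0.ne']
      calc p y * Real.log (q y / p y) ≤ p y * (q y / p y - 1) :=
            mul_le_mul_of_nonneg_left (Real.log_le_sub_one_of_pos (div_pos (hpq y h0) h0)) h0.le
        _ = q y - p y := by field_simp
  have := Finset.sum_le_sum h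
  rw [Finset.sum_sub_distrib, Finset.sum_sub_distrib, hp.2, hq.2] at this
  linarith

theorem mul_log_nonpos_of_mem {Y : Type*} [Fintype Y] {q : Y → ℝ} (hq : q ∈ stdSimplex ℝ Y)
    (y : Y) {a : ℝ} (ha : 0 ≤ a) : a * Real.log (q y) ≤ 0 :=
  mul_nonpos_of_nonneg_of_nonpos ha (Real.log_nonpos (hq.1 y)
    (hq.2 ▸ Finset.single_le_sum (fun y _ => hq.1 y) (Finset.mem_univ y)))

/-- There is an output law from which no row of the channel has divergence above the capacity. -/
theorem exists_outputLaw {X Y : Type*} [Fintype X] [Fintype Y] {W : X → Y → ℝ}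
    (hW : IsKernel W) (hC : 0 < capacity W) :
    ∃ q ∈ stdSimplex ℝ Y, ∀ x, (∀ y, 0 < W x y → 0 < q y) ∧
      ∑ y, W x y * Real.log (W x y / q y) ≤ capacity W * Real.log 2 := by
  classical
  obtain ⟨p, hp, hpC, hmax⟩ := exists_isMaxOn_mutualInfo hW hC
  have h2 : 0 < Real.log 2 := Real.log_pos (by norm_num)
  set q : Y → ℝ := fun y => ∑ x, p x * W x y with hq
  have hqs : q ∈ stdSimplex ℝ Y := sum_mul_mem_stdSimplex hW hp
  set J := capacity W * Real.log 2 with hJ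
  set h : X → ℝ := fun x => ∑ y, W x y * Real.log (W x y) with hh
  have hJp : J = ∑ x, p x * h x - ∑ y, q y * Real.log (q y) := by
    rw [hJ, ← hpC, mutualInfo_mul_log_two hW hp, sub_eq_add_neg, ← Finset.sum_neg_distrib]
    simp only [Real.negMulLog, neg_mul, hq, hh]
  -- Move the optimal input law a fraction `l` towards the point mass at `x`. Optimality bounds the
  -- new mutual information by `J`; Gibbs' inequality bounds its `1 - l` part below by `(1 - l) *
  -- J`, and dividing by `l` leaves the claim.
  have hmix : ∀ x, ∀ l ∈ Set.Ioo (0 : ℝ) 1,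
      h x - ∑ y, W x y * Real.log ((1 - l) * q y + l * W x y) ≤ J := by
    rintro x l ⟨hl0, hl1⟩
    set p' : X → ℝ := fun z => (1 - l) * p z + l * (Pi.single x 1 : X → ℝ) z with hp'
    have hp's : p' ∈ stdSimplex ℝ X :=
      convex_stdSimplex ℝ X hp (single_mem_stdSimplex ℝ x) (by linarith) hl0.le (by ring)
    have hsum : ∀ f : X → ℝ, ∑ z, p' z * f z = (1 - l) * ∑ z, p z * f z + l * f x := by
      intro f
      simp only [hp', add_mul, Finset.sum_add_distrib, mul_assoc, ← Finset.mul_sum]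
      simp [Pi.single_apply]
    have hq' : ∀ y, ∑ z, p' z * W z y = (1 - l) * q y + l * W x y := fun y =>
      hsum fun z => W z y
    have hqs' := sum_mul_mem_stdSimplex hW hp's
    simp only [hq'] at hqs'
    have h1 := mul_le_mul_of_nonneg_right (hmax p' hp's) h2.le
    rw [hpC, ← hJ, mutualInfo_mul_log_two hW hp's, hsum] at h1
    simp only [hq', Real.negMulLog, neg_mul, Finset.sum_neg_distrib, add_mul, mul_assoc,
      Finset.sum_add_distrib, ← Finset.mul_sum] at h1
    have h3 := sum_mul_log_le_sum_mul_log hqs hqs' fun y hy => by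
      have := (hW x).1 y
      have : 0 < (1 - l) * q y := mul_pos (by linarith) hy
      positivity
    have h4 := mul_le_mul_of_nonneg_left h3 (show 0 ≤ 1 - l by linarith)
    have h5 : l * (h x - ∑ y, W x y * Real.log ((1 - l) * q y + l * W x y)) ≤ l * J := by
      have h6 : (1 - l) * J = (1 - l) * ∑ x, p x * h x -
        (1 - l) * ∑ y, q y * Real.log (q y) := by rw [hJp, mul_sub]
      rw [mul_sub]
      linarith
    exact le_of_mul_le_mul_left h5 hl0
  have hpos : ∀ x y, 0 < W x y → 0 < q y := by
    intro x y hxy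
    refine (hqs.1 y).lt_of_ne' fun h0 => ?_
    -- If the optimal law missed an output reachable from `x`, the left side of `hmix` would blow up
    -- as `l` tends to 0.
    have hlim : Tendsto (fun l : ℝ => h x - W x y * Real.log (l * W x y)) (𝓝[>] 0) atTop := by
      have h1 : Tendsto (fun l : ℝ => l * W x y) (𝓝[>] 0) (𝓝[>] 0) := by
        refine tendsto_nhdsWithin_iff.2 ⟨?_, ?_⟩
        · have : Tendsto (fun l : ℝ => l * W x y) (𝓝 0) (𝓝 (0 * W x y)) :=
            (continuous_id.mul continuous_const).tendsto 0
          rw [zero_mul] at this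
          exact this.mono_left nhdsWithin_le_nhds
        · filter_upwards [self_mem_nhdsWithin] with l hl
          exact mul_pos hl hxy
      have h3 := (Real.tendsto_log_nhdsGT_zero.comp h1).const_mul_atBot hxy
      have h4 := tendsto_atTop_add_const_left _ (h x) (tendsto_neg_atBot_atTop.comp h3)
      simpa [Function.comp_def, sub_eq_add_neg] using h4
    obtain ⟨l, hl, hlm⟩ := ((hlim.eventually_gt_atTop J).and
      (Ioo_mem_nhdsGT (zero_lt_one' ℝ))).exists
    refine absurd (hmix x l hlm) (not_le.2 (hl.trans_le (sub_le_sub_left ?_ _)))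
    have hqs' : (fun y => (1 - l) * q y + l * W x y) ∈ stdSimplex ℝ Y :=
      convex_stdSimplex ℝ Y hqs (hW x) (by linarith [hlm.2]) hlm.1.le (by ring)
    rw [← Finset.add_sum_erase _ _ (Finset.mem_univ y), h0, mul_zero, zero_add]
    exact add_le_of_nonpos_right
      (Finset.sum_nonpos fun y' _ => mul_log_nonpos_of_mem hqs' y' ((hW x).1 y'))
  refine ⟨q, hqs, fun x => ⟨hpos x, ?_⟩⟩
  have hlim : Tendsto (fun l : ℝ => h x - ∑ y, W x y * Real.log ((1 - l) * q y + l * W x y))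
      (𝓝[>] 0) (𝓝 (h x - ∑ y, W x y * Real.log (q y))) := by
    refine Tendsto.mono_left ?_ nhdsWithin_le_nhds
    refine tendsto_const_nhds.sub (tendsto_finsetSum _ fun y _ => ?_)
    rcases ((hW x).1 y).eq_or_lt with h0 | h0
    · simp [← h0]
    · refine Tendsto.const_mul _ (Tendsto.log ?_ (hpos x y h0).ne')
      have : Continuous fun l : ℝ => (1 - l) * q y + l * W x y := by fun_prop
      simpa using this.tendsto 0
  have hle := le_of_tendsto hlim (Filter.mem_of_superset (Ioo_mem_nhdsGT (zero_lt_one' ℝ))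
    (hmix x))
  refine le_trans (le_of_eq ?_) hle
  rw [hh, ← Finset.sum_sub_distrib]
  refine Finset.sum_congr rfl fun y _ => ?_
  rcases ((hW x).1 y).eq_or_lt with h0 | h0
  · simp [← h0]
  · rw [Real.log_div h0.ne' (hpos x y h0).ne', mul_sub]

/-! ### Converse bounds -/

/-- A dual converse: likelihood functions `G` whose mean under `w` is at most one at every output
have expected logarithm at most the largest divergence of a row from the output law `q`. -/
theorem sum_log_le_of_divergence_le {α Y : Type*} [Fintype α] [Fintype Y] {w : α → ℝ}
    (hw : w ∈ stdSimplex ℝ α) {V : α → Y → ℝ} (hV : IsKernel V) {q : Y → ℝ}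
    (hq : q ∈ stdSimplex ℝ Y) {D : ℝ}
    (hD : ∀ s, (∀ y, 0 < V s y → 0 < q y) ∧ ∑ y, V s y * Real.log (V s y / q y) ≤ D)
    {G : α → Y → ℝ} (hG : ∀ s y, 0 < G s y) (hG1 : ∀ y, ∑ s, w s * G s y ≤ 1) :
    ∑ s, w s * ∑ y, V s y * Real.log (G s y) ≤ D := by
  -- Change of measure from `V s` to `q`, by `log z ≤ z - 1` at `z = q y * G s y / V s y`. Averaged
  -- over `w`, the correction is nonpositive by `hG1`.
  have hpt : ∀ s, ∑ y, V s y * Real.log (G s y) ≤ D + (∑ y, q y * G s y - 1) := by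
    intro s
    have h1 : ∀ y ∈ Finset.univ, V s y * Real.log (G s y) ≤
        V s y * Real.log (V s y / q y) + (q y * G s y - V s y) := by
      intro y _
      rcases ((hV s).1 y).eq_or_lt with h0 | h0
      · simpa [← h0] using mul_nonneg (hq.1 y) (hG s y).le
      · have hqy := (hD s).1 y h0
        have hz := Real.log_le_sub_one_of_pos (div_pos (mul_pos hqy (hG s y)) h0)
        rw [Real.log_div (mul_pos hqy (hG s y)).ne' h0.ne',
          Real.log_mul hqy.ne' (hG s y).ne'] at hz
        have := mul_le_mul_of_nonneg_left hz h0.le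
        rw [mul_sub, mul_add, mul_sub, mul_one, mul_div_cancel₀ _ h0.ne'] at this
        rw [Real.log_div h0.ne' hqy.ne']
        linarith
    have h2 := Finset.sum_le_sum h1
    rw [Finset.sum_add_distrib, Finset.sum_sub_distrib, (hV s).2] at h2
    linarith [(hD s).2]
  calc ∑ s, w s * ∑ y, V s y * Real.log (G s y)
      ≤ ∑ s, w s * (D + (∑ y, q y * G s y - 1)) :=
        Finset.sum_le_sum fun s _ => mul_le_mul_of_nonneg_left (hpt s) (hw.1 s)
    _ = D + (∑ y, q y * ∑ s, w s * G s y - 1) := by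
        have hswap : ∑ s, w s * ∑ y, q y * G s y = ∑ y, q y * ∑ s, w s * G s y := by
          simp_rw [Finset.mul_sum]
          rw [Finset.sum_comm]
          simp_rw [mul_left_comm]
        simp only [mul_add, mul_sub, Finset.sum_add_distrib, Finset.sum_sub_distrib, hswap,
          ← Finset.sum_mul, hw.2, mul_one, one_mul]
    _ ≤ D + (∑ y, q y * 1 - 1) := by
        gcongr with y
        · exact hq.1 y
        · exact hG1 y
    _ = D := by simp [hq.2]

/-- Divergence between product laws adds over the coordinates. -/
theorem memoryless_divergence_le {X Y : Type*} [Fintype Y] {W : X → Y → ℝ}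
    (hW : IsKernel W) {q : Y → ℝ} {D : ℝ}
    (hD : ∀ x, (∀ y, 0 < W x y → 0 < q y) ∧ ∑ y, W x y * Real.log (W x y / q y) ≤ D)
    {n : ℕ} (x : Fin n → X) :
    (∀ y : Fin n → Y, 0 < memoryless W x y → 0 < ∏ i, q (y i)) ∧
      ∑ y : Fin n → Y, memoryless W x y * Real.log (memoryless W x y / ∏ i, q (y i)) ≤
        n * D := by
  have hpos : ∀ y : Fin n → Y, 0 < memoryless W x y → ∀ i, 0 < W (x i) (y i) := fun y hy i =>
    ((hW _).1 _).lt_of_ne' fun h0 => hy.ne' (Finset.prod_eq_zero (Finset.mem_univ i) h0)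
  refine ⟨fun y hy => Finset.prod_pos fun i _ => (hD _).1 _ (hpos y hy i), ?_⟩
  have h1 : ∀ y : Fin n → Y, memoryless W x y * Real.log (memoryless W x y / ∏ i, q (y i)) =
      (∏ i, W (x i) (y i)) * ∑ i, Real.log (W (x i) (y i) / q (y i)) := by
    intro y
    rcases ((memoryless_isKernel hW n x).1 y).eq_or_lt with h0 | h0
    · rw [← h0, zero_mul, ← memoryless, ← h0, zero_mul]
    · rw [memoryless, ← Finset.prod_div_distrib, Real.log_prod]
      exact fun i _ => (div_pos (hpos y h0 i) ((hD _).1 _ (hpos y h0 i))).ne'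
  simp_rw [h1]
  rw [sum_pi_prod_mul_sum (v := fun i => W (x i)) (fun i => (hW _).2)
    fun i b => Real.log (W (x i) b / q b)]
  refine (Finset.sum_le_sum fun i _ => (hD (x i)).2).trans ?_
  simp

/-- The dual converse for `n` uses of a memoryless channel. -/
theorem sum_log_le_capacity {α X Y : Type*} [Fintype α] [Fintype X] [Fintype Y] {W : X → Y → ℝ}
    (hW : IsKernel W) (hC : 0 < capacity W) {w : α → ℝ} (hw : w ∈ stdSimplex ℝ α) {n : ℕ}
    (f : α → Fin n → X) {G : α → (Fin n → Y) → ℝ} (hG : ∀ s y, 0 < G s y)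
    (hG1 : ∀ y, ∑ s, w s * G s y ≤ 1) :
    ∑ s, w s * ∑ y, memoryless W (f s) y * Real.log (G s y) ≤
      n * (capacity W * Real.log 2) := by
  obtain ⟨q, hq, hD⟩ := exists_outputLaw hW hC
  exact sum_log_le_of_divergence_le hw (fun s => memoryless_isKernel hW n (f s))
    (q := fun y => ∏ i, q (y i))
    ⟨fun y => Finset.prod_nonneg fun i _ => hq.1 _, sum_pi_prod_eq_one fun _ => hq.2⟩
    (fun s => memoryless_divergence_le hW hD (f s)) hG hG1

/-- Fano's bound for a code with messages `α` of average error at most `ε`. -/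
theorem logb_card_le_of_code {α X Y : Type*} [Fintype α] [DecidableEq α] [Nonempty α]
    [Fintype X] [Fintype Y] {W : X → Y → ℝ} (hW : IsKernel W) (hC : 0 < capacity W) {n : ℕ}
    (f : α → Fin n → X) (g : (Fin n → Y) → Option α) {ε : ℝ}
    (herr : ∀ a, ∑ y, (if g y = some a then 0 else memoryless W (f a) y) ≤ ε) :
    (1 - ε) * Real.logb 2 (Fintype.card α) - 1 ≤ n * capacity W := by
  have hl2 : 0 < Real.log 2 := Real.log_pos (by norm_num)
  set M : ℝ := ((Fintype.card α : ℕ) : ℝ) with hM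
  have hM0 : 0 < M := by simp [hM, Fintype.card_pos]
  have hM1 : 1 ≤ M := by
    rw [hM]
    exact_mod_cast Nat.succ_le_of_lt (Fintype.card_pos (α := α))
  have hw : (fun _ : α => M⁻¹) ∈ stdSimplex ℝ α := by
    refine ⟨fun _ => inv_nonneg.2 hM0.le, ?_⟩
    simp [hM]
  -- Relative to the uniform prior, `G` dominates the posterior that puts half its mass on the
  -- decoded message and spreads none elsewhere, with a floor of 1/2 that keeps the logarithm
  -- finite. The factor 1/2 costs the one bit in the bound.
  have key := sum_log_le_capacity hW hC hw f
    (G := fun a y => if g y = some a then M / 2 else 1 / 2)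
    (fun a y => by split_ifs <;> positivity) (fun y => by
      have h1 : ∀ a, M⁻¹ * (if g y = some a then M / 2 else 1 / 2) ≤
          (if g y = some a then 1 / 2 else 0) + M⁻¹ * (1 / 2) := by
        intro a
        split_ifs
        · have : M⁻¹ * (M / 2) = 1 / 2 := by field_simp
          rw [this]
          simp [hM0.le]
        · simp
      refine (Finset.sum_le_sum fun a _ => h1 a).trans ?_
      rw [Finset.sum_add_distrib, ← Finset.sum_mul, hw.2]
      have : ∑ a, (if g y = some a then (1 : ℝ) / 2 else 0) ≤ 1 / 2 := by
        cases hgy : g y with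
        | none => simp
        | some b => simp
      linarith)
  have hrow : ∀ a, (1 - ε) * Real.log M - Real.log 2 ≤
      ∑ y, memoryless W (f a) y * Real.log (if g y = some a then M / 2 else 1 / 2) := by
    intro a
    have h1 : ∀ y, memoryless W (f a) y * Real.log (if g y = some a then M / 2 else 1 / 2) =
        memoryless W (f a) y * (Real.log M - Real.log 2) -
          (if g y = some a then 0 else memoryless W (f a) y) * Real.log M := by
      intro y
      split_ifs
      · rw [Real.log_div hM0.ne' (by norm_num)]
        ring
      · rw [Real.log_div one_ne_zero (by norm_num), Real.log_one]
        ring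
    simp_rw [h1]
    rw [Finset.sum_sub_distrib, ← Finset.sum_mul, ← Finset.sum_mul,
      (memoryless_isKernel hW n (f a)).2]
    have := mul_le_mul_of_nonneg_right (herr a) (Real.log_nonneg hM1)
    linarith
  have h3 : (1 - ε) * Real.log M - Real.log 2 ≤ n * (capacity W * Real.log 2) := by
    refine le_trans ?_ key
    rw [← Finset.mul_sum]
    have := Finset.sum_le_sum fun a (_ : a ∈ Finset.univ) => hrow a
    rw [Finset.sum_const, Finset.card_univ, nsmul_eq_mul, ← hM] at this
    rwa [inv_mul_eq_div, le_div_iff₀ hM0, mul_comm]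
  rw [Real.logb]
  have h4 : (1 - ε) * (Real.log M / Real.log 2) - 1 =
      ((1 - ε) * Real.log M - Real.log 2) / Real.log 2 := by field_simp
  rw [h4, div_le_iff₀ hl2]
  linarith


/-! ### The rate of a subset -/

theorem mass_nonneg {U : Type*} [DecidableEq U] {S : Finset U} {P : S → ℝ} (hP : ∀ s, 0 ≤ P s)
    (B : Finset U) : 0 ≤ mass P B :=
  Finset.sum_nonneg fun s _ => by split_ifs <;> simp [hP]

theorem le_mass {U : Type*} [DecidableEq U] {S : Finset U} {P : S → ℝ} (hP : ∀ s, 0 ≤ P s)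
    {B : Finset U} {s : S} (hs : (s : U) ∈ B) : P s ≤ mass P B := by
  have := Finset.single_le_sum (f := fun s : S => if (s : U) ∈ B then P s else 0)
    (fun s _ => by split_ifs <;> simp [hP]) (Finset.mem_univ s)
  exact (if_pos hs).ge.trans this

theorem mass_mono {U : Type*} [DecidableEq U] {S : Finset U} {P : S → ℝ} (hP : ∀ s, 0 ≤ P s)
    {B B' : Finset U} (h : B ⊆ B') : mass P B ≤ mass P B' := by
  refine Finset.sum_le_sum fun s _ => ?_
  by_cases hs : (s : U) ∈ B
  · simp [hs, h hs]
  · rw [if_neg hs]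
    split_ifs <;> simp [hP]

/-- Dividing by the mass cancels, leaving a sum whose terms can be compared one by one when `B`
grows. -/
theorem subsetRate_mul_log_two {U : Type*} [DecidableEq U] {S : Finset U} {P : S → ℝ}
    (hP : ∀ s, 0 ≤ P s) (B : Finset U) :
    subsetRate P B * Real.log 2 =
      ∑ s : S, if (s : U) ∈ B then P s * (Real.log (mass P B) - Real.log (P s)) else 0 := by
  have h2 : Real.log 2 ≠ 0 := (Real.log_pos (by norm_num)).ne'
  rw [subsetRate, entropy, ← Finset.sum_div, mul_assoc, div_mul_cancel₀ _ h2, Finset.mul_sum]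
  refine Finset.sum_congr rfl fun s _ => ?_
  rw [condLaw]
  split_ifs with hs
  · rcases (hP s).eq_or_lt with h0 | h0
    · simp [← h0]
    · have hm := h0.trans_le (le_mass hP hs)
      rw [Real.negMulLog, Real.log_div h0.ne' hm.ne']
      field_simp
      ring
  · simp

/-- Enlarging the set raises the mass in each old term, and every new term is nonnegative because no
letter outweighs its set. -/
theorem subsetRate_mono {U : Type*} [DecidableEq U] {S : Finset U} {P : S → ℝ}
    (hP : ∀ s, 0 ≤ P s) {B B' : Finset U} (h : B ⊆ B') : subsetRate P B ≤ subsetRate P B' := by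
  refine le_of_mul_le_mul_right ?_ (Real.log_pos (one_lt_two (α := ℝ)))
  rw [subsetRate_mul_log_two hP, subsetRate_mul_log_two hP]
  refine Finset.sum_le_sum fun s _ => ?_
  rcases (hP s).eq_or_lt with h0 | h0
  · simp [← h0]
  by_cases hs : (s : U) ∈ B
  · rw [if_pos hs, if_pos (h hs)]
    have := Real.log_le_log (h0.trans_le (le_mass hP hs)) (mass_mono hP h)
    gcongr
  · rw [if_neg hs]
    split_ifs with hs'
    · exact mul_nonneg h0.le (sub_nonneg.2 (Real.log_le_log h0 (le_mass hP hs')))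
    · exact le_rfl

theorem subsetRate_eq_zero_of_card_le_one {U : Type*} [DecidableEq U] {S : Finset U} {P : S → ℝ}
    (hP : ∀ s, 0 ≤ P s) {B : Finset U} (hB : B.card ≤ 1) : subsetRate P B = 0 := by
  have h2 : Real.log 2 ≠ 0 := (Real.log_pos (by norm_num)).ne'
  refine (mul_eq_zero.1 ?_).resolve_right h2
  rw [subsetRate_mul_log_two hP]
  refine Finset.sum_eq_zero fun s _ => ?_
  split_ifs with hs
  · have : mass P B = P s := by
      rw [mass, Finset.sum_eq_single s]
      · simp [hs]
      · intro s' _ hne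
        exact if_neg fun hs' => hne (Subtype.ext (Finset.card_le_one.1 hB _ hs' _ hs))
      · simp
    simp [this]
  · rfl

theorem subsetRate_self {U : Type*} [DecidableEq U] {S : Finset U} {P : S → ℝ}
    (hP : P ∈ stdSimplex ℝ S) : subsetRate P S = entropy P := by
  have h : mass P S = 1 := by
    rw [← hP.2]
    exact Finset.sum_congr rfl fun s _ => if_pos s.2
  have h' : condLaw P S = P := by
    ext s
    simp [condLaw, h]
  rw [subsetRate, h, h', one_mul]

/-! ### Properties of the constrained distortion -/

theorem T_mono {U : Type*} (R : Set (HornRule U)) : Monotone (T R) := by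
  rintro Γ Δ h s (hs | ⟨r, hr, hp, rfl⟩)
  · exact Or.inl (h hs)
  · exact Or.inr ⟨r, hr, fun p hp' => h (hp p hp'), rfl⟩

theorem subset_iterate_T {U : Type*} (R : Set (HornRule U)) (Γ : Set U) (n : ℕ) :
    Γ ⊆ (T R)^[n] Γ :=
  iterate_T_mono R Γ (Nat.zero_le n)

theorem mem_atomDelta {U : Type*} {R : Set (HornRule U)} {S : Finset U} {δ : ℕ} {s : U} :
    s ∈ atomDelta R S δ ↔ s ∈ S ∧ s ∉ (T R)^[δ] ((S : Set U) \ {s}) := by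
  classical
  exact Finset.mem_filter

theorem atomDelta_subset {U : Type*} (R : Set (HornRule U)) (S : Finset U) (δ : ℕ) :
    atomDelta R S δ ⊆ S := fun _ hs => (mem_atomDelta.1 hs).1

theorem deltaDist_nonneg {U : Type*} (R : Set (HornRule U)) (S : Finset U) (δ : ℕ) (s t : U) :
    0 ≤ deltaDist R S δ s t := by
  unfold deltaDist
  split_ifs <;> simp

theorem deltaDist_le_one {U : Type*} (R : Set (HornRule U)) (S : Finset U) (δ : ℕ) (s t : U) :
    deltaDist R S δ s t ≤ 1 := by
  unfold deltaDist
  split_ifs <;> simp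

theorem deltaDist_eq_one_of_ne_zero {U : Type*} {R : Set (HornRule U)} {S : Finset U} {δ : ℕ}
    {s t : U} (h : deltaDist R S δ s t ≠ 0) : deltaDist R S δ s t = 1 := by
  unfold deltaDist at *
  split_ifs at * <;> simp_all

theorem deltaDist_self {U : Type*} (R : Set (HornRule U)) (S : Finset U) (δ : ℕ) (s : U) :
    deltaDist R S δ s s = 0 := by
  refine if_pos (Set.Subset.trans ?_ (subset_iterate_T R _ δ))
  rw [Set.sdiff_union_self]
  exact Set.subset_union_left

/-- Whatever is substituted for such a letter, the remaining base already restores it in time. -/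
theorem deltaDist_eq_zero_of_notMem {U : Type*} {R : Set (HornRule U)} {S : Finset U} {δ : ℕ}
    {s : U} (hs : s ∈ S) (h : s ∉ atomDelta R S δ) (t : U) : deltaDist R S δ s t = 0 := by
  have h1 : s ∈ (T R)^[δ] ((S : Set U) \ {s}) := by
    by_contra hn
    exact h (mem_atomDelta.2 ⟨hs, hn⟩)
  have h2 := (T_mono R).iterate δ (Set.subset_union_left (s := (S : Set U) \ {s}) (t := {t}))
  refine if_pos fun u hu => ?_
  by_cases hus : u = s
  · exact hus ▸ h2 h1
  · exact subset_iterate_T R _ δ (Or.inl ⟨hu, hus⟩)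

theorem DeltaCoreDisjoint.eq {U : Type*} {R : Set (HornRule U)} {S Shat : Finset U} {δ : ℕ}
    (h : DeltaCoreDisjoint R S Shat δ) {a₁ a₂ t : U} (h₁ : a₁ ∈ atomDelta R S δ)
    (h₂ : a₂ ∈ atomDelta R S δ) (ht : t ∈ Shat) (hd₁ : deltaDist R S δ a₁ t = 0)
    (hd₂ : deltaDist R S δ a₂ t = 0) : a₁ = a₂ := by
  by_contra hne
  exact Set.disjoint_left.1 (h a₁ h₁ a₂ h₂ hne) ⟨ht, hd₁⟩ ⟨ht, hd₂⟩

/-! ### The converse for block transmission -/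

/-- Letterwise functions `G`, of mean at most one under the source law for every reconstruction,
have expected logarithm at most the capacity, up to the distortion. -/
theorem sum_le_capacity_add_dist {U X Y : Type*} [Fintype X] [Fintype Y]
    {R : Set (HornRule U)} {S Shat : Finset U} {P : S → ℝ} (hP : P ∈ stdSimplex ℝ S)
    {W : X → Y → ℝ} (hW : IsKernel W) (hC : 0 < capacity W) {δ : ℕ} {G : S → Shat → ℝ}
    (hG : ∀ s t, 0 < G s t) (hG1 : ∀ t, ∑ s, P s * G s t ≤ 1) {F : S → ℝ} {K : ℝ}
    (hF : ∀ s (t : Shat), F s - K * deltaDist R S δ s t ≤ Real.log (G s t)) {m : ℕ} (hm : 0 < m)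
    (f : (Fin m → S) → Fin m → X) (g : (Fin m → Y) → Fin m → Shat) :
    ∑ s, P s * F s ≤ capacity W * Real.log 2 + K * expectedDist R P W δ f g := by
  have hw : (fun s : Fin m → S => ∏ i, P (s i)) ∈ stdSimplex ℝ (Fin m → S) :=
    ⟨fun s => Finset.prod_nonneg fun i _ => hP.1 _, sum_pi_prod_eq_one fun _ => hP.2⟩
  have hm0 : (0 : ℝ) < m := by exact_mod_cast hm
  have key := sum_log_le_capacity hW hC hw f (G := fun s y => ∏ i, G (s i) (g y i))
    (fun s y => Finset.prod_pos fun i _ => hG _ _) (fun y => by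
      simp_rw [← Finset.prod_mul_distrib]
      rw [sum_pi_prod fun i a => P a * G a (g y i)]
      exact Finset.prod_le_one
        (fun i _ => Finset.sum_nonneg fun a _ => mul_nonneg (hP.1 a) (hG _ _).le)
        fun i _ => hG1 _)
  have hrow : ∀ s : Fin m → S, ∑ i, F (s i) - K * (m * ∑ y, memoryless W (f s) y *
      ((m : ℝ)⁻¹ * ∑ i, deltaDist R S δ (s i) (g y i))) ≤
      ∑ y, memoryless W (f s) y * Real.log (∏ i, G (s i) (g y i)) := by
    intro s
    have h1 : ∑ i, F (s i) = ∑ y, memoryless W (f s) y * ∑ i, F (s i) := by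
      rw [← Finset.sum_mul, (memoryless_isKernel hW m (f s)).2, one_mul]
    rw [h1, Finset.mul_sum, Finset.mul_sum, ← Finset.sum_sub_distrib]
    refine Finset.sum_le_sum fun y _ => ?_
    have h2 : memoryless W (f s) y * ∑ i, F (s i) - K * (m * (memoryless W (f s) y *
        ((m : ℝ)⁻¹ * ∑ i, deltaDist R S δ (s i) (g y i)))) =
        memoryless W (f s) y * ∑ i, (F (s i) - K * deltaDist R S δ (s i) (g y i)) := by
      rw [Finset.sum_sub_distrib, ← Finset.mul_sum]
      field_simp
    rw [h2, Real.log_prod fun i _ => (hG _ _).ne']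
    exact mul_le_mul_of_nonneg_left (Finset.sum_le_sum fun i _ => hF _ _)
      ((memoryless_isKernel hW m (f s)).1 y)
  have h3 := (Finset.sum_le_sum fun s (_ : s ∈ Finset.univ) =>
    mul_le_mul_of_nonneg_left (hrow s) (hw.1 s)).trans key
  simp only [mul_sub, Finset.sum_sub_distrib] at h3
  rw [sum_pi_prod_mul_sum (v := fun _ : Fin m => P) (fun _ => hP.2) fun _ => F] at h3
  have h4 : ∑ s : Fin m → S, (∏ i, P (s i)) * (K * (m * ∑ y, memoryless W (f s) y *
      ((m : ℝ)⁻¹ * ∑ i, deltaDist R S δ (s i) (g y i)))) = m * (K * expectedDist R P W δ f g) := by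
    rw [expectedDist, Finset.mul_sum, Finset.mul_sum]
    exact Finset.sum_congr rfl fun s _ => by ring
  rw [h4] at h3
  simp only [Finset.sum_const, Finset.card_univ, Fintype.card_fin, nsmul_eq_mul] at h3
  refine le_of_mul_le_mul_left ?_ hm0
  linarith

/-- The letterwise bound is applied to a smoothed likelihood ratio with parameter `η`. The
blocklength goes to infinity first, removing the distortion term, and then `η` goes to 0. -/
theorem subsetRate_le_capacity_of_reliable {U X Y : Type*} [DecidableEq U] [Fintype X]
    [Fintype Y] {R : Set (HornRule U)} {S Shat : Finset U} {P : S → ℝ}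
    (hP : P ∈ stdSimplex ℝ S) {W : X → Y → ℝ} (hW : IsKernel W) (hC : 0 < capacity W) {δ : ℕ}
    (hdis : DeltaCoreDisjoint R S Shat δ) (hrel : ReliableAtDelay R Shat P W δ) :
    subsetRate P (atomDelta R S δ) ≤ capacity W := by
  have hl2 : 0 < Real.log 2 := Real.log_pos (by norm_num)
  set A := atomDelta R S δ with hA
  set μ := mass P A with hμ
  rcases (mass_nonneg hP.1 A).eq_or_lt with h0 | hμ0
  · rw [subsetRate, ← h0, zero_mul]
    exact hC.le
  rw [← hμ] at hμ0
  obtain ⟨f, g, hlim⟩ := hrel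
  have main : ∀ η ∈ Set.Ioo (0 : ℝ) 1,
      subsetRate P A * Real.log 2 + μ * Real.log (1 - η) ≤ capacity W * Real.log 2 := by
    rintro η ⟨hη0, hη1⟩
    -- A correct core letter gets nearly its inverse conditional probability, a wrong one only `η`.
    -- Since at most one core letter matches a given `t`, the mean is at most `(1 - η) * μ + η * μ +
    -- (1 - μ) = 1`. Letters of probability zero are set aside to keep `G` positive.
    set G : S → Shat → ℝ := fun s t =>
      if (s : U) ∈ A ∧ P s ≠ 0 then
        if deltaDist R S δ s t = 0 then (1 - η) * (μ / P s) else η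
      else 1 with hGdef
    set F : S → ℝ := fun s =>
      if (s : U) ∈ A ∧ P s ≠ 0 then Real.log ((1 - η) * (μ / P s)) else 0 with hFdef
    have hpos : ∀ s : S, P s ≠ 0 → 0 < (1 - η) * (μ / P s) := fun s hs =>
      mul_pos (by linarith) (div_pos hμ0 ((hP.1 s).lt_of_ne' hs))
    have hG : ∀ s t, 0 < G s t := by
      intro s t
      simp only [hGdef]
      split_ifs with h1 h2
      · exact hpos s h1.2
      · exact hη0
      · exact one_pos
    have hG1 : ∀ t, ∑ s, P s * G s t ≤ 1 := by
      intro t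
      have h1 : ∀ s : S, P s * G s t ≤ P s - (1 - η) * (if (s : U) ∈ A then P s else 0) +
          (if (s : U) ∈ A ∧ deltaDist R S δ s t = 0 then (1 - η) * μ else 0) := by
        intro s
        have hs0 := hP.1 s
        have hnn : 0 ≤ (1 - η) * μ := mul_nonneg (by linarith) hμ0.le
        by_cases hs : (s : U) ∈ A
        · by_cases hp : P s = 0
          · simp only [hp, hs]
            split_ifs <;> simp [hnn]
          · by_cases hd : deltaDist R S δ s t = 0
            · have : P s * ((1 - η) * (μ / P s)) = (1 - η) * μ := by field_simp
              simp only [hGdef, hs, hp, hd, ne_eq, not_false_eq_true, and_self, if_true, this]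
              nlinarith
            · simp only [hGdef, hs, hp, hd, ne_eq, not_false_eq_true, and_self, and_false,
                if_true, if_false]
              nlinarith
        · simp [hGdef, hs]
      have h2 : ∑ s : S, (if (s : U) ∈ A ∧ deltaDist R S δ s t = 0 then (1 - η) * μ else 0) ≤
          (1 - η) * μ := by
        rw [← Finset.sum_filter, Finset.sum_const, nsmul_eq_mul]
        refine mul_le_of_le_one_left (mul_nonneg (by linarith) hμ0.le) ?_
        have : (Finset.univ.filter fun s : S =>
            (s : U) ∈ A ∧ deltaDist R S δ s t = 0).card ≤ 1 := by
          refine Finset.card_le_one.2 fun s₁ h₁ s₂ h₂ => Subtype.ext ?_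
          rw [Finset.mem_filter] at h₁ h₂
          exact hdis.eq h₁.2.1 h₂.2.1 t.2 h₁.2.2 h₂.2.2
        exact_mod_cast this
      have h3 := Finset.sum_le_sum fun s (_ : s ∈ Finset.univ) => h1 s
      rw [Finset.sum_add_distrib, Finset.sum_sub_distrib, ← Finset.mul_sum, hP.2] at h3
      have h4 : ∑ s : S, (if (s : U) ∈ A then P s else 0) = μ := rfl
      rw [h4] at h3
      linarith
    -- The factor of the distortion only has to dominate `F s - log η`; it does not depend on the
    -- blocklength.
    have hF : ∀ s (t : Shat), F s - (∑ s, |F s| - Real.log η) * deltaDist R S δ s t ≤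
        Real.log (G s t) := by
      intro s t
      have hlη : Real.log η ≤ 0 := Real.log_nonpos hη0.le hη1.le
      have hFs : F s ≤ ∑ s, |F s| := (le_abs_self _).trans
        (Finset.single_le_sum (f := fun s => |F s|) (fun _ _ => abs_nonneg _) (Finset.mem_univ s))
      by_cases hd : deltaDist R S δ s t = 0
      · rw [hd, mul_zero, sub_zero]
        simp only [hFdef, hGdef, hd, if_true]
        split_ifs <;> simp
      · rw [deltaDist_eq_one_of_ne_zero hd, mul_one]
        have : Real.log η ≤ Real.log (G s t) := by
          simp only [hGdef, hd, if_false]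
          split_ifs
          · exact le_rfl
          · simp [hlη]
        linarith
    have hbound : ∑ s, P s * F s ≤ capacity W * Real.log 2 := by
      have hlim' := (hlim.const_mul (∑ s, |F s| - Real.log η)).const_add
        (capacity W * Real.log 2)
      rw [mul_zero, add_zero] at hlim'
      refine ge_of_tendsto hlim' ?_
      filter_upwards [eventually_gt_atTop 0] with m hm
      exact sum_le_capacity_add_dist hP hW hC hG hG1 hF hm (f m) (g m)
    refine le_trans (le_of_eq ?_) hbound
    rw [subsetRate_mul_log_two hP.1, ← hμ, hμ, mass, Finset.sum_mul, ← Finset.sum_add_distrib]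
    refine Finset.sum_congr rfl fun s _ => ?_
    rw [← mass, ← hμ]
    simp only [hFdef]
    by_cases hs : (s : U) ∈ A
    · by_cases hp : P s = 0
      · simp [hp]
      · rw [if_pos hs, if_pos hs, if_pos ⟨hs, hp⟩, Real.log_mul (by linarith)
          (div_ne_zero hμ0.ne' hp), Real.log_div hμ0.ne' hp]
        ring
    · simp [hs]
  have hlim2 : Tendsto (fun η : ℝ => subsetRate P A * Real.log 2 + μ * Real.log (1 - η))
      (𝓝[>] 0) (𝓝 (subsetRate P A * Real.log 2 + μ * Real.log (1 - 0))) := by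
    refine Tendsto.mono_left ?_ nhdsWithin_le_nhds
    refine tendsto_const_nhds.add (Tendsto.const_mul _ (Tendsto.log ?_ (by norm_num)))
    exact tendsto_const_nhds.sub tendsto_id
  have := le_of_tendsto hlim2 (Filter.mem_of_superset (Ioo_mem_nhdsGT (zero_lt_one' ℝ)) main)
  rw [sub_zero, Real.log_one, mul_zero, add_zero] at this
  exact le_of_mul_le_mul_right this hl2


/-! ### Covering an i.i.d. source -/

/-- If every message is matched with probability at least `τ` under the law `ν`, then some `M`
words leave at most a fraction `(1 - τ) ^ M` of the messages unmatched. -/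
theorem exists_greedy_covering {α β : Type*} [Fintype α] [Fintype β] {Q : α → ℝ}
    (hQ : ∀ s, 0 ≤ Q s) (hQ1 : ∑ s, Q s ≤ 1) {ν : β → ℝ} (hν : ν ∈ stdSimplex ℝ β)
    (ok : α → β → Prop) [∀ s c, Decidable (ok s c)] {τ : ℝ} (hτ : τ ≤ 1)
    (h : ∀ s, Q s ≠ 0 → τ ≤ ∑ c, if ok s c then ν c else 0) (M : ℕ) :
    ∃ c : ℕ → β, ∑ s, (if ∃ j < M, ok s (c j) then 0 else Q s) ≤ (1 - τ) ^ M := by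
  induction M with
  | zero =>
    obtain ⟨b, -⟩ := exists_le_of_le_sum_mul (v := 0) (c := 0) hν (by simp)
    exact ⟨fun _ => b, by simpa using hQ1⟩
  | succ M ih =>
    obtain ⟨c, hc⟩ := ih
    set Q' : α → ℝ := fun s => if ∃ j < M, ok s (c j) then 0 else Q s with hQ'
    have hQ'0 : ∀ s, 0 ≤ Q' s := fun s => by simp only [hQ']; split_ifs <;> simp [hQ]
    -- A random word drawn from `ν` captures on average at least a fraction `τ` of the mass still
    -- unmatched, so some word does.
    have hav : τ * ∑ s, Q' s ≤ ∑ b, ν b * ∑ s, (if ok s b then Q' s else 0) := by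
      have h1 : ∑ b, ν b * ∑ s, (if ok s b then Q' s else 0) =
          ∑ s, Q' s * ∑ b, if ok s b then ν b else 0 := by
        simp_rw [Finset.mul_sum]
        rw [Finset.sum_comm]
        refine Finset.sum_congr rfl fun s _ => Finset.sum_congr rfl fun b _ => ?_
        split_ifs
        · ring
        · simp
      rw [h1, Finset.mul_sum]
      refine Finset.sum_le_sum fun s _ => ?_
      rw [mul_comm]
      by_cases hs : Q s = 0
      · simp [hQ', hs]
      · exact mul_le_mul_of_nonneg_left (h s hs) (hQ'0 s)
    obtain ⟨b, hb⟩ := exists_le_of_le_sum_mul hν hav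
    refine ⟨fun j => if j < M then c j else b, ?_⟩
    have h2 : ∀ s, (if ∃ j < M + 1, ok s (if j < M then c j else b) then 0 else Q s) ≤
        Q' s - if ok s b then Q' s else 0 := by
      intro s
      by_cases hcov : ∃ j < M, ok s (c j)
      · obtain ⟨j, hj, hok⟩ := hcov
        rw [if_pos ⟨j, by omega, by simpa [hj] using hok⟩]
        have : Q' s = 0 := if_pos ⟨j, hj, hok⟩
        simp [this]
      · have hQs : Q' s = Q s := if_neg hcov
        by_cases hok : ok s b
        · rw [if_pos ⟨M, by omega, by simpa using hok⟩, if_pos hok, sub_self]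
        · rw [if_neg hok, sub_zero, hQs]
          split_ifs <;> simp [hQ]
    refine (Finset.sum_le_sum fun s _ => h2 s).trans ?_
    rw [Finset.sum_sub_distrib, pow_succ]
    have := mul_le_mul_of_nonneg_right hc (sub_nonneg.2 hτ)
    linarith

/-- Blocks of an i.i.d. source are matched, with high probability, by one of about `2 ^ (k * r)`
words, if `r` exceeds the mean of minus the logarithm of the letterwise matching probability. -/
theorem exists_covering {α β : Type*} [Fintype α] [Fintype β] {P : α → ℝ}
    (hP : P ∈ stdSimplex ℝ α) {ν : β → ℝ} (hν : ν ∈ stdSimplex ℝ β)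
    (ok : α → β → Prop) [∀ s c, Decidable (ok s c)]
    (hpos : ∀ a, P a ≠ 0 → 0 < ∑ b, if ok a b then ν b else 0) {r : ℝ}
    (hr : ∑ a, P a * -Real.logb 2 (∑ b, if ok a b then ν b else 0) < r) {ε : ℝ} (hε : 0 < ε) :
    ∀ᶠ k : ℕ in atTop, ∀ M : ℕ, (2 : ℝ) ^ (k * r) ≤ M + 1 →
      ∃ c : ℕ → Fin k → β, ∑ s : Fin k → α,
        (if ∃ j < M, ∀ i, ok (s i) (c j i) then 0 else ∏ i, P (s i)) ≤ ε := by
  set κ : α → ℝ := fun a => ∑ b, if ok a b then ν b else 0 with hκ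
  have hκ0 : ∀ a, 0 ≤ κ a := fun a => Finset.sum_nonneg fun b _ => by
    split_ifs <;> simp [hν.1]
  obtain ⟨r', hr'1, hr'2⟩ := exists_between hr
  have hr'0 : 0 ≤ r' := by
    refine le_trans (Finset.sum_nonneg fun a _ => mul_nonneg (hP.1 a) ?_) hr'1.le
    refine neg_nonneg.2 (Real.logb_nonpos one_lt_two (hκ0 a) ?_)
    rw [← hν.2]
    exact Finset.sum_le_sum fun b _ => by split_ifs <;> simp [hν.1]
  have hg : ∑ a, P a * (-Real.logb 2 (κ a) - r') < 0 := by
    simp_rw [mul_sub, Finset.sum_sub_distrib, ← Finset.sum_mul, hP.2]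
    linarith
  obtain ⟨ρ, hρ0, hρ1, hρ⟩ := exists_prob_sum_nonneg_le hP hg
  have hlim : Tendsto (fun k : ℕ => Real.exp (1 - ((2 : ℝ) ^ (r - r')) ^ k) + ρ ^ k) atTop
      (𝓝 (0 + 0)) := by
    refine Tendsto.add (Real.tendsto_exp_atBot.comp ?_)
      (tendsto_pow_atTop_nhds_zero_of_lt_one hρ0 hρ1)
    have h1 := tendsto_pow_atTop_atTop_of_one_lt
      (Real.one_lt_rpow (one_lt_two (α := ℝ)) (sub_pos.2 hr'2))
    simpa [Function.comp_def, sub_eq_add_neg] using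
      tendsto_atBot_add_const_left _ (1 : ℝ) (tendsto_neg_atTop_atBot.comp h1)
  rw [add_zero] at hlim
  filter_upwards [hlim.eventually (gt_mem_nhds hε)] with k hk M hM
  set τ : ℝ := 2 ^ (-(k * r')) with hτ
  have hτ1 : τ ≤ 1 := Real.rpow_le_one_of_one_le_of_nonpos one_le_two
    (neg_nonpos.2 (mul_nonneg (Nat.cast_nonneg k) hr'0))
  have hτ0 : 0 < τ := by positivity
  have hPk : ∀ s : Fin k → α, 0 ≤ ∏ i, P (s i) := fun s => Finset.prod_nonneg fun i _ => hP.1 _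
  have hPk1 : ∑ s : Fin k → α, ∏ i, P (s i) = 1 := sum_pi_prod_eq_one fun _ => hP.2
  -- Only blocks whose matching probability is at least `τ` are covered greedily; the others are
  -- rare by the Chernoff bound.
  set Q : (Fin k → α) → ℝ := fun s => if τ ≤ ∏ i, κ (s i) then ∏ i, P (s i) else 0 with hQ
  have hmatch : ∀ s : Fin k → α, ∑ c : Fin k → β, (if ∀ i, ok (s i) (c i) then ∏ i, ν (c i) else 0) =
      ∏ i, κ (s i) := by
    intro s
    rw [← sum_pi_prod fun i b => if ok (s i) b then ν b else 0]
    refine Finset.sum_congr rfl fun c _ => ?_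
    rw [Finset.prod_ite_zero]
    simp
  obtain ⟨c, hc⟩ := exists_greedy_covering (Q := Q) (ν := fun c : Fin k → β => ∏ i, ν (c i))
    (fun s => by simp only [hQ]; split_ifs <;> simp [hPk])
    (by
      rw [← hPk1]
      exact Finset.sum_le_sum fun s _ => by simp only [hQ]; split_ifs <;> simp [hPk])
    ⟨fun c => Finset.prod_nonneg fun i _ => hν.1 _, sum_pi_prod_eq_one fun _ => hν.2⟩
    (fun s c => ∀ i, ok (s i) (c i)) hτ1
    (fun s hs => by
      rw [hmatch]
      by_contra hn
      exact hs (if_neg hn)) M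
  have hatyp := hρ k (fun s => ¬ τ ≤ ∏ i, κ (s i)) (fun s hs hsP => by
    have hκs : ∀ i, 0 < κ (s i) := fun i => hpos _ (hsP i)
    have := Real.logb_lt_logb one_lt_two (Finset.prod_pos fun i _ => hκs i) (not_le.1 hs)
    rw [hτ, Real.logb_rpow (by norm_num) (by norm_num),
      Real.logb_prod _ _ fun i _ => (hκs i).ne'] at this
    rw [Finset.sum_sub_distrib, Finset.sum_neg_distrib]
    simp only [Finset.sum_const, Finset.card_univ, Fintype.card_fin, nsmul_eq_mul]
    linarith)
  refine ⟨c, le_trans ?_ hk.le⟩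
  -- Here `(1 - τ) ^ M ≤ exp (-τ * M)`, and `M ≥ 2 ^ (k * r) - 1` with `τ ≤ 1` accounts for the
  -- summand 1 in the exponent.
  have hpow : (1 - τ) ^ M ≤ Real.exp (1 - ((2 : ℝ) ^ (r - r')) ^ k) := by
    have h1 : 1 - τ ≤ Real.exp (-τ) := by linarith [Real.add_one_le_exp (-τ)]
    refine (pow_le_pow_left₀ (sub_nonneg.2 hτ1) h1 M).trans ?_
    rw [← Real.exp_nat_mul]
    refine Real.exp_le_exp.2 ?_
    have h2 : ((2 : ℝ) ^ (r - r')) ^ k = 2 ^ (k * r) * τ := by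
      rw [hτ, ← Real.rpow_natCast, ← Real.rpow_mul (by norm_num), ← Real.rpow_add (by norm_num)]
      congr 1
      ring
    rw [h2]
    have := mul_le_mul_of_nonneg_right hM hτ0.le
    linarith
  refine le_trans ?_ (add_le_add (hc.trans hpow) hatyp)
  rw [← Finset.sum_add_distrib]
  refine Finset.sum_le_sum fun s _ => ?_
  by_cases h1 : ∃ j < M, ∀ i, ok (s i) (c j i)
  · rw [if_pos h1, if_pos h1, zero_add]
    split_ifs <;> simp [hPk]
  · rw [if_neg h1, if_neg h1]
    by_cases h2 : τ ≤ ∏ i, κ (s i) <;> simp [hQ, h2]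

/-- Marginalization of a product law to an initial block. -/
theorem sum_prod_mul_castAdd {α : Type*} [Fintype α] {P : α → ℝ} (hP : ∑ a, P a = 1) {k l : ℕ}
    (F : (Fin k → α) → ℝ) :
    ∑ s : Fin (k + l) → α, (∏ i, P (s i)) * F (fun i => s (Fin.castAdd l i)) =
      ∑ s : Fin k → α, (∏ i, P (s i)) * F s := by
  rw [← (Fin.appendEquiv k l).sum_comp, Fintype.sum_prod_type]
  refine Finset.sum_congr rfl fun s _ => ?_
  have h : ∀ t : Fin l → α, (∏ i, P (Fin.appendEquiv k l (s, t) i)) *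
      F (fun i => Fin.appendEquiv k l (s, t) (Fin.castAdd l i)) =
      (∏ i, P (s i)) * F s * ∏ i, P (t i) := by
    intro t
    rw [Fin.prod_univ_add]
    simp only [Fin.appendEquiv, Equiv.coe_fn_mk, Fin.append_left, Fin.append_right]
    ring
  simp_rw [h]
  rw [← Finset.mul_sum, sum_pi_prod_eq_one fun _ => hP, mul_one]

/-! ### The direct part for block transmission -/

/-- Combine a covering of the first `k` letters with a channel code for `m` uses; the remaining
letters are given up. -/
theorem exists_block_code {U X Y : Type*} [Fintype X] [Fintype Y]
    {R : Set (HornRule U)} {S Shat : Finset U} {P : S → ℝ} (hP : P ∈ stdSimplex ℝ S)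
    {W : X → Y → ℝ} (hW : IsKernel W) {δ : ℕ} {k m M : ℕ} (hkm : k ≤ m) (hm : 0 < m)
    (hShat : Shat.Nonempty) {ε₁ ε₂ : ℝ} (hε₂ : 0 ≤ ε₂) (c : ℕ → Fin k → Shat)
    [∀ (s : Fin k → S) j i, Decidable (deltaDist R S δ (s i) (c j i) = 0)]
    (hc : ∑ s : Fin k → S, (if ∃ j < M, ∀ i, deltaDist R S δ (s i) (c j i) = 0 then 0
      else ∏ i, P (s i)) ≤ ε₁)
    (x : ℕ → Fin m → X) (d : (Fin m → Y) → ℕ)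
    (hx : ∀ j < M, ∑ y, (if d y = j then 0 else memoryless W (x j) y) ≤ ε₂) :
    ∃ (f : (Fin m → S) → Fin m → X) (g : (Fin m → Y) → Fin m → Shat),
      expectedDist R P W δ f g ≤ ((m - k : ℕ) : ℝ) / m + ε₂ + ε₁ := by
  classical
  obtain ⟨l, rfl⟩ := Nat.exists_eq_add_of_le hkm
  obtain ⟨b, hb⟩ := hShat
  have hm0 : (0 : ℝ) < ((k + l : ℕ) : ℝ) := by exact_mod_cast hm
  set cov : (Fin k → S) → Prop := fun s => ∃ j < M, ∀ i, deltaDist R S δ (s i) (c j i) = 0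
    with hcov
  set idx : (Fin k → S) → ℕ := fun s => if h : cov s then h.choose else 0 with hidx
  have hidx_spec : ∀ s, cov s → idx s < M ∧ ∀ i, deltaDist R S δ (s i) (c (idx s) i) = 0 := by
    intro s h
    simp only [hidx, dif_pos h]
    exact h.choose_spec
  set hd : (Fin (k + l) → S) → Fin k → S := fun s i => s (Fin.castAdd l i) with hhd
  refine ⟨fun s => x (idx (hd s)), fun y => Fin.append (c (d y)) fun _ => ⟨b, hb⟩, ?_⟩
  have hlen : (((k + l - k : ℕ) : ℝ)) = l := by simp
  rw [hlen]
  -- Each of the `l` abandoned letters costs at most 1; the first `k` cost nothing if the block is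
  -- covered and its index decoded, so the default index of an uncovered block is harmless.
  have hdist : ∀ (s : Fin (k + l) → S) (y : Fin (k + l) → Y),
      (((k + l : ℕ) : ℝ))⁻¹ * ∑ i, deltaDist R S δ (s i)
        ((Fin.append (c (d y)) fun _ => (⟨b, hb⟩ : Shat)) i : Shat) ≤
      l / ((k + l : ℕ) : ℝ) + if cov (hd s) ∧ d y = idx (hd s) then 0 else 1 := by
    intro s y
    rw [inv_mul_le_iff₀ hm0, mul_add, mul_div_cancel₀ _ hm0.ne']
    rw [Fin.sum_univ_add]
    simp only [Fin.append_left, Fin.append_right]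
    have h1 : ∑ i : Fin l, deltaDist R S δ (s (Fin.natAdd k i)) b ≤ l := by
      refine (Finset.sum_le_sum fun i _ => deltaDist_le_one R S δ _ _).trans ?_
      simp
    by_cases h : cov (hd s) ∧ d y = idx (hd s)
    · rw [if_pos h, mul_zero, h.2]
      have h2 : ∑ i : Fin k, deltaDist R S δ (s (Fin.castAdd l i)) (c (idx (hd s)) i) = 0 :=
        Finset.sum_eq_zero fun i _ => (hidx_spec _ h.1).2 i
      linarith
    · rw [if_neg h, mul_one]
      have h2 : ∑ i : Fin k, deltaDist R S δ (s (Fin.castAdd l i)) (c (d y) i) ≤ k := by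
        refine (Finset.sum_le_sum fun i _ => deltaDist_le_one R S δ _ _).trans ?_
        simp
      push_cast
      linarith [Nat.cast_nonneg (α := ℝ) l]
  have hrow : ∀ s : Fin (k + l) → S, ∑ y, memoryless W (x (idx (hd s))) y *
      ((((k + l : ℕ) : ℝ))⁻¹ * ∑ i, deltaDist R S δ (s i)
        ((Fin.append (c (d y)) fun _ => (⟨b, hb⟩ : Shat)) i : Shat)) ≤
      l / ((k + l : ℕ) : ℝ) + ε₂ + if cov (hd s) then 0 else 1 := by
    intro s
    have hK := memoryless_isKernel hW (k + l) (x (idx (hd s)))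
    refine (Finset.sum_le_sum fun y _ => mul_le_mul_of_nonneg_left (hdist s y) (hK.1 y)).trans ?_
    simp_rw [mul_add]
    rw [Finset.sum_add_distrib, ← Finset.sum_mul, hK.2, one_mul, add_assoc]
    gcongr
    by_cases h : cov (hd s)
    · rw [if_pos h, add_zero]
      refine le_trans (le_of_eq ?_) (hx _ (hidx_spec _ h).1)
      refine Finset.sum_congr rfl fun y _ => ?_
      by_cases hy : d y = idx (hd s) <;> simp [h, hy]
    · simp only [h, false_and, if_false, mul_one]
      rw [hK.2]
      linarith
  rw [expectedDist]
  refine (Finset.sum_le_sum fun s _ => mul_le_mul_of_nonneg_left (hrow s)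
    (Finset.prod_nonneg fun i _ => hP.1 _)).trans ?_
  simp_rw [mul_add _ (_ + _)]
  rw [Finset.sum_add_distrib, ← Finset.sum_mul, sum_pi_prod_eq_one fun _ => hP.2, one_mul]
  gcongr
  have := sum_prod_mul_castAdd hP.2 (l := l) fun s : Fin k → S => if cov s then (0 : ℝ) else 1
  rw [this]
  refine le_trans (le_of_eq ?_) hc
  refine Finset.sum_congr rfl fun s _ => ?_
  by_cases h : cov s
  · rw [if_pos h, mul_zero]
    exact (if_pos h).symm
  · rw [if_neg h, mul_one]
    exact (if_neg h).symm

/-- A reconstruction law whose matching cost is at most `P_δ H(π_δ)`. -/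
theorem exists_reconstruction_law {U : Type*} [DecidableEq U] {R : Set (HornRule U)}
    {S Shat : Finset U} {P : S → ℝ} (hP : P ∈ stdSimplex ℝ S) {δ : ℕ} (hShat : Shat.Nonempty)
    (hsub : atomDelta R S δ ⊆ Shat)
    [∀ (s : S) (t : Shat), Decidable (deltaDist R S δ s t = 0)] :
    ∃ ν ∈ stdSimplex ℝ Shat,
      (∀ s : S, P s ≠ 0 → 0 < ∑ t : Shat, if deltaDist R S δ s t = 0 then ν t else 0) ∧
      ∑ s : S, P s * -Real.logb 2 (∑ t : Shat, if deltaDist R S δ s t = 0 then ν t else 0) ≤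
        subsetRate P (atomDelta R S δ) := by
  have hl2 : 0 < Real.log 2 := Real.log_pos (by norm_num)
  obtain ⟨b, hb⟩ := hShat
  set A := atomDelta R S δ with hA
  -- The conditional law on `A` is the right choice; if `A` has mass zero any law will do, and `P`
  -- serves.
  obtain ⟨π, hπ, hπP⟩ : ∃ π ∈ stdSimplex ℝ S, ∀ s : S, (s : U) ∈ A → P s ≠ 0 →
      π s = P s / mass P A := by
    rcases (mass_nonneg hP.1 A).eq_or_lt with h0 | h0
    · exact ⟨P, hP, fun s hs hp => absurd (le_antisymm (h0 ▸ le_mass hP.1 hs) (hP.1 s)) hp⟩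
    · refine ⟨condLaw P A, ⟨fun s => ?_, ?_⟩, fun s hs _ => if_pos hs⟩
      · unfold condLaw
        split_ifs
        · exact div_nonneg (hP.1 s) h0.le
        · exact le_rfl
      · have : ∀ s, condLaw P A s = (if (s : U) ∈ A then P s else 0) / mass P A := fun s => by
          unfold condLaw
          split_ifs <;> simp
        simp_rw [this]
        rw [← Finset.sum_div]
        exact div_self h0.ne'
  set φ : S → Shat := fun s => if h : (s : U) ∈ Shat then ⟨s, h⟩ else ⟨b, hb⟩ with hφ
  set ν : Shat → ℝ := fun t => ∑ s, if φ s = t then π s else 0 with hν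
  have hν0 : ∀ t, 0 ≤ ν t := fun t => Finset.sum_nonneg fun s _ => by
    split_ifs <;> simp [hπ.1]
  have hν1 : ∑ t, ν t = 1 := by
    rw [hν, Finset.sum_comm, ← hπ.2]
    exact Finset.sum_congr rfl fun s _ => by simp
  set κ : S → ℝ := fun s => ∑ t : Shat, if deltaDist R S δ s t = 0 then ν t else 0 with hκ
  -- Letters outside `A` match everything and cost nothing; a letter of `A` matches at least itself,
  -- so its cost is at most minus the logarithm of its conditional probability.
  have hκ1 : ∀ s : S, (s : U) ∉ A → κ s = 1 := fun s hs => by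
    rw [← hν1]
    exact Finset.sum_congr rfl fun t _ => if_pos (deltaDist_eq_zero_of_notMem s.2 hs t)
  have hκA : ∀ s : S, (s : U) ∈ A → P s ≠ 0 → P s / mass P A ≤ κ s := fun s hs hp => by
    have hφs : (φ s : U) = s := by simp [hφ, hsub hs]
    rw [← hπP s hs hp]
    have h1 : π s ≤ ν (φ s) := by
      refine le_trans (le_of_eq ?_) (Finset.single_le_sum
        (f := fun s' => if φ s' = φ s then π s' else 0)
        (fun s' _ => by split_ifs <;> simp [hπ.1]) (Finset.mem_univ s))
      simp
    refine h1.trans (le_trans (le_of_eq ?_) (Finset.single_le_sum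
      (f := fun t : Shat => if deltaDist R S δ s t = 0 then ν t else 0)
      (fun t _ => by split_ifs <;> simp [hν0]) (Finset.mem_univ (φ s))))
    exact (if_pos (by rw [hφs, deltaDist_self])).symm
  have hratio : ∀ s : S, (s : U) ∈ A → P s ≠ 0 → 0 < P s ∧ 0 < mass P A := fun s hs hp =>
    have h := (hP.1 s).lt_of_ne' hp
    ⟨h, h.trans_le (le_mass hP.1 hs)⟩
  refine ⟨ν, ⟨hν0, hν1⟩, fun s hp => ?_, ?_⟩
  · change 0 < κ s
    by_cases hs : (s : U) ∈ A
    · exact (div_pos (hratio s hs hp).1 (hratio s hs hp).2).trans_le (hκA s hs hp)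
    · exact (hκ1 s hs).symm ▸ one_pos
  · refine le_of_mul_le_mul_right ?_ hl2
    rw [subsetRate_mul_log_two hP.1, Finset.sum_mul]
    refine Finset.sum_le_sum fun s _ => ?_
    change P s * -Real.logb 2 (κ s) * Real.log 2 ≤ _
    rw [Real.logb, mul_assoc, neg_mul, div_mul_cancel₀ _ hl2.ne']
    by_cases hs : (s : U) ∈ A
    · rw [if_pos hs]
      by_cases hp : P s = 0
      · simp [hp]
      · obtain ⟨h1, h2⟩ := hratio s hs hp
        refine mul_le_mul_of_nonneg_left ?_ h1.le
        have := Real.log_le_log (div_pos h1 h2) (hκA s hs hp)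
        rw [Real.log_div h1.ne' h2.ne'] at this
        linarith
    · rw [if_neg hs, hκ1 s hs]
      simp

/-- Rate equal to capacity is allowed: only about a fraction `1 - e` of the letters is described, at
`(1 + e) * C` bits each, so the channel carries `(1 - e ^ 2) * C < C` bits per use. -/
theorem eventually_exists_expectedDist_le {U X Y : Type*} [DecidableEq U] [Fintype X]
    [Fintype Y] {R : Set (HornRule U)} {S Shat : Finset U} {P : S → ℝ}
    (hP : P ∈ stdSimplex ℝ S) {W : X → Y → ℝ} (hW : IsKernel W) (hC : 0 < capacity W) {δ : ℕ}
    (hShat : Shat.Nonempty) (hsub : atomDelta R S δ ⊆ Shat)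
    (hrate : subsetRate P (atomDelta R S δ) ≤ capacity W)
    {ε : ℝ} (hε : 0 < ε) :
    ∀ᶠ m : ℕ in atTop, ∃ (f : (Fin m → S) → Fin m → X)
      (g : (Fin m → Y) → Fin m → Shat), expectedDist R P W δ f g ≤ ε := by
  classical
  set C := capacity W with hCdef
  obtain ⟨ν, hν, hνpos, hνrate⟩ := exists_reconstruction_law hP hShat hsub
  -- The total is at most `4 * e`: abandoned letters and rounding cost `2 * e`, covering and channel
  -- errors `e` each.
  obtain ⟨e, he0, he⟩ : ∃ e : ℝ, 0 < e ∧ e < min 1 (ε / 4) := exists_between (by positivity)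
  have he1 : e < 1 := he.trans_le (min_le_left _ _)
  have he4 : e < ε / 4 := he.trans_le (min_le_right _ _)
  set r : ℝ := (1 - e) * ((1 + e) * C) with hr
  have hr0 : 0 ≤ r := mul_nonneg (by linarith) (mul_nonneg (by linarith) hC.le)
  have hrC : r < C := by
    have : 0 < e * e * C := by positivity
    rw [hr]
    linarith
  have hcov := exists_covering hP hν (fun (s : S) (t : Shat) => deltaDist R S δ s t = 0) hνpos
    (r := (1 + e) * C) (by
      have : 0 < e * C := by positivity
      linarith) he0
  have hk : Tendsto (fun m : ℕ => ⌊(1 - e) * m⌋₊) atTop atTop :=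
    tendsto_nat_floor_atTop.comp
      (tendsto_natCast_atTop_atTop.const_mul_atTop (by linarith : 0 < 1 - e))
  filter_upwards [hk.eventually hcov, exists_channel_code hW hr0 hrC he0,
    eventually_gt_atTop 0, tendsto_natCast_atTop_atTop.eventually_ge_atTop (1 / e)]
    with m h1 h2 hm hme
  set k := ⌊(1 - e) * m⌋₊ with hkdef
  have hm0 : (0 : ℝ) < m := by exact_mod_cast hm
  have hkle : (k : ℝ) ≤ (1 - e) * m := Nat.floor_le (mul_nonneg (by linarith) hm0.le)
  have hklt : (1 - e) * m < k + 1 := Nat.lt_floor_add_one _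
  have hkm : k ≤ m := by
    have : (k : ℝ) ≤ m := by nlinarith
    exact_mod_cast this
  set M := ⌊(2 : ℝ) ^ (k * ((1 + e) * C))⌋₊ with hM
  obtain ⟨c, hc⟩ := h1 M (Nat.lt_floor_add_one _).le
  obtain ⟨x, d, hx⟩ := h2 M (by
    refine (Nat.floor_le (by positivity)).trans
      (Real.rpow_le_rpow_of_exponent_le one_le_two ?_)
    rw [hr]
    have := mul_le_mul_of_nonneg_right hkle
      (mul_nonneg (by linarith) hC.le : 0 ≤ (1 + e) * C)
    linarith)
  obtain ⟨f, g, hfg⟩ := exists_block_code hP hW hkm hm hShat he0.le c hc x d hx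
  refine ⟨f, g, hfg.trans ?_⟩
  have h3 : ((m - k : ℕ) : ℝ) / m ≤ 2 * e := by
    rw [div_le_iff₀ hm0, Nat.cast_sub hkm]
    have : 1 ≤ e * m := by
      rw [div_le_iff₀ he0] at hme
      linarith
    linarith
  linarith

/-- Taking a best code at each blocklength, among finitely many, gives one sequence that works for
all `ε` at once. -/
theorem exists_tendsto_zero_of_eventually_exists_le {ι : ℕ → Type*} [∀ m, Finite (ι m)]
    [∀ m, Nonempty (ι m)] (D : ∀ m, ι m → ℝ) (h0 : ∀ m t, 0 ≤ D m t)
    (h : ∀ ε > 0, ∀ᶠ m in atTop, ∃ t, D m t ≤ ε) :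
    ∃ t : ∀ m, ι m, Tendsto (fun m => D m (t m)) atTop (𝓝 0) := by
  choose t ht using fun m => Finite.exists_min (D m)
  refine ⟨t, tendsto_order.2 ⟨fun a ha => Eventually.of_forall fun m => ha.trans_le (h0 m _),
    fun a ha => ?_⟩⟩
  filter_upwards [h (a / 2) (half_pos ha)] with m ⟨t', ht'⟩
  linarith [ht m t']

theorem reliable_of_subsetRate_le_capacity {U X Y : Type*} [DecidableEq U] [Fintype X]
    [Fintype Y] {R : Set (HornRule U)} {S Shat : Finset U} {P : S → ℝ}
    (hP : P ∈ stdSimplex ℝ S) {W : X → Y → ℝ} (hW : IsKernel W) (hC : 0 < capacity W) {δ : ℕ}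
    (hShat : Shat.Nonempty) (hsub : atomDelta R S δ ⊆ Shat)
    (hrate : subsetRate P (atomDelta R S δ) ≤ capacity W) : ReliableAtDelay R Shat P W δ := by
  have hX : Nonempty X := by
    obtain ⟨p, hp, -⟩ := exists_mutualInfo_gt le_rfl hC
    obtain ⟨x, -⟩ := exists_le_of_le_sum_mul (v := 0) (c := 0) hp (by simp)
    exact ⟨x⟩
  have hSh : Nonempty Shat := hShat.to_subtype
  obtain ⟨fg, hfg⟩ := exists_tendsto_zero_of_eventually_exists_le
    (ι := fun m => ((Fin m → S) → Fin m → X) × ((Fin m → Y) → Fin m → Shat))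
    (fun m fg => expectedDist R P W δ fg.1 fg.2)
    (fun m fg => Finset.sum_nonneg fun s _ =>
      mul_nonneg (Finset.prod_nonneg fun i _ => hP.1 _) (Finset.sum_nonneg fun y _ =>
        mul_nonneg ((memoryless_isKernel hW m _).1 y) (mul_nonneg (by positivity)
          (Finset.sum_nonneg fun i _ => deltaDist_nonneg R S δ _ _))))
    (fun ε hε => by
      filter_upwards [eventually_exists_expectedDist_le hP hW hC hShat hsub hrate hε]
        with m ⟨f, g, h⟩
      exact ⟨(f, g), h⟩)
  exact ⟨fun m => (fg m).1, fun m => (fg m).2, hfg⟩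


/-! ### Single-message codes -/

/-- Codes for `M` messages of length about `log M / C`. -/
theorem exists_short_code {X Y : Type*} [Fintype X] [Fintype Y] {W : X → Y → ℝ}
    (hW : IsKernel W) (hC : 0 < capacity W) {ε η : ℝ} (hε : 0 < ε) (hη : 0 < η) :
    ∃ K : ℕ, ∀ M ≥ K, ∃ n : ℕ, (n : ℝ) ≤ (1 + η) * (Real.logb 2 M / capacity W) ∧
      ∃ (c : ℕ → Fin n → X) (g : (Fin n → Y) → ℕ),
        ∀ j < M, ∑ y, (if g y = j then 0 else memoryless W (c j) y) ≤ ε := by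
  set C := capacity W with hCdef
  have hden : 0 < 1 + η / 2 := by linarith
  have hr : C / (1 + η / 2) < C := div_lt_self hC (by linarith)
  have hL : Tendsto (fun M : ℕ => Real.logb 2 M / C) atTop atTop :=
    ((Real.tendsto_logb_atTop one_lt_two).comp tendsto_natCast_atTop_atTop).atTop_div_const hC
  have hn : Tendsto (fun M : ℕ => ⌊(1 + η) * (Real.logb 2 M / C)⌋₊) atTop atTop :=
    tendsto_nat_floor_atTop.comp (hL.const_mul_atTop (by linarith : 0 < 1 + η))
  -- The rate `C / (1 + η / 2)` needs length `(1 + η / 2) * L`, where `L = logb 2 M / C`; once `L ≥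
  -- 2 / η`, the other half of `η` absorbs the rounding down.
  obtain ⟨K, hK⟩ := eventually_atTop.1
    ((hn.eventually (exists_channel_code hW (div_pos hC hden).le hr hε)).and
      ((hL.eventually_ge_atTop (2 / η)).and (eventually_gt_atTop 0)))
  refine ⟨K, fun M hM => ?_⟩
  obtain ⟨h1, h2, hM0⟩ := hK M hM
  have hMpos : (0 : ℝ) < M := by exact_mod_cast hM0
  have hL0 : 0 ≤ Real.logb 2 M / C := (by positivity : 0 ≤ 2 / η).trans h2
  refine ⟨_, Nat.floor_le (mul_nonneg (by linarith) hL0), h1 M ?_⟩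
  have h3 := Nat.lt_floor_add_one ((1 + η) * (Real.logb 2 M / C))
  set n := ⌊(1 + η) * (Real.logb 2 M / C)⌋₊
  have h4 : (1 + η / 2) * (Real.logb 2 M / C) ≤ n := by
    rw [div_le_iff₀ hη] at h2
    linarith
  calc (M : ℝ) = 2 ^ Real.logb 2 M :=
        (Real.rpow_logb two_pos (by norm_num) hMpos).symm
    _ ≤ 2 ^ (n * (C / (1 + η / 2))) := by
        refine Real.rpow_le_rpow_of_exponent_le one_le_two ?_
        have h5 := mul_le_mul_of_nonneg_right h4 (div_pos hC hden).le
        refine le_trans (le_of_eq ?_) h5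
        field_simp

/-- By disjointness a reconstruction identifies the only core letter it can serve, so restricting
the messages to `atomDelta R S δ` yields an ordinary channel code, to which Fano's bound applies. -/
theorem logb_card_le_of_mem_blocklengths {U X Y : Type*} [Fintype X] [Fintype Y]
    {R : Set (HornRule U)} {S Shat : Finset U} {W : X → Y → ℝ} (hW : IsKernel W)
    (hC : 0 < capacity W) {δ : ℕ} (hdis : DeltaCoreDisjoint R S Shat δ) {ε : ℝ} {n : ℕ}
    (hn : n ∈ blocklengths R S Shat W δ ε) :
    (1 - ε) * Real.logb 2 ((atomDelta R S δ).card : ℝ) - 1 ≤ n * capacity W := by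
  classical
  obtain ⟨f, g, hfg⟩ := hn
  rcases (atomDelta R S δ).eq_empty_or_nonempty with h0 | hne
  · rw [h0]
    simp only [Finset.card_empty, Nat.cast_zero, Real.logb_zero, mul_zero]
    have : 0 ≤ n * capacity W := mul_nonneg (Nat.cast_nonneg n) hC.le
    linarith
  have hA : ∀ a ∈ atomDelta R S δ, a ∈ S := fun a ha => (mem_atomDelta.1 ha).1
  have : Nonempty (atomDelta R S δ) := hne.to_subtype
  have key := logb_card_le_of_code hW hC (fun a : atomDelta R S δ => f ⟨a, hA a a.2⟩)
    (fun y => if h : ∃ a : atomDelta R S δ, deltaDist R S δ a (g y) = 0 then some h.choose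
      else none) (ε := ε) (fun a => by
      refine le_trans ?_ ((le_ciSup (Set.finite_range _).bddAbove ⟨a, hA a a.2⟩).trans hfg)
      refine Finset.sum_le_sum fun y _ => ?_
      have hV := (memoryless_isKernel hW n (f ⟨a, hA a a.2⟩)).1 y
      by_cases hd : deltaDist R S δ a (g y) = 0
      · have h : ∃ a : atomDelta R S δ, deltaDist R S δ a (g y) = 0 := ⟨a, hd⟩
        have heq : h.choose = a :=
          Subtype.ext (hdis.eq h.choose.2 a.2 (g y).2 h.choose_spec hd)
        rw [dif_pos h, heq, if_pos rfl]
        split_ifs <;> simp [hV]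
      · have hpos := (deltaDist_nonneg R S δ a (g y)).lt_of_ne' hd
        refine le_trans ?_ (if_pos hpos).ge
        split_ifs <;> simp [hV])
  simpa using key

/-- Only the letters of `atomDelta R S δ` need codewords of their own; every other message is
error-free whatever is decoded. Allowing `M` above the cardinality lets a small core use a code
built for many messages. -/
theorem mem_blocklengths_of_code {U X Y : Type*} [Fintype Y]
    {R : Set (HornRule U)} {S Shat : Finset U} (hS : S.Nonempty) (hShat : Shat.Nonempty)
    {W : X → Y → ℝ} (hW : IsKernel W) {δ : ℕ} (hsub : atomDelta R S δ ⊆ Shat) {ε : ℝ}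
    (hε : 0 ≤ ε) {n M : ℕ} (hM : (atomDelta R S δ).card ≤ M) (c : ℕ → Fin n → X)
    (d : (Fin n → Y) → ℕ)
    (hc : ∀ j < M, ∑ y, (if d y = j then 0 else memoryless W (c j) y) ≤ ε) :
    n ∈ blocklengths R S Shat W δ ε := by
  classical
  obtain ⟨b, hb⟩ := hShat
  have : Nonempty S := hS.to_subtype
  set A := atomDelta R S δ with hA
  refine ⟨fun s => if h : (s : U) ∈ A then c (A.equivFin ⟨s, h⟩) else c 0,
    fun y => if h : d y < A.card then
      ⟨A.equivFin.symm ⟨d y, h⟩, hsub (A.equivFin.symm ⟨d y, h⟩).2⟩ else ⟨b, hb⟩, ?_⟩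
  refine ciSup_le fun s => ?_
  by_cases hs : (s : U) ∈ A
  · refine le_trans (Finset.sum_le_sum fun y _ => ?_)
      (hc (A.equivFin ⟨s, hs⟩) ((A.equivFin ⟨s, hs⟩).2.trans_le hM))
    beta_reduce
    rw [dif_pos hs]
    have hV := (memoryless_isKernel hW n (c (A.equivFin ⟨s, hs⟩))).1 y
    by_cases hy : d y = A.equivFin ⟨s, hs⟩
    · have hlt : d y < A.card := hy ▸ (A.equivFin ⟨s, hs⟩).2
      have hfin : (⟨d y, hlt⟩ : Fin A.card) = A.equivFin ⟨s, hs⟩ := Fin.ext hy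
      rw [if_pos hy, dif_pos hlt, if_neg]
      rw [hfin]
      simp [deltaDist_self]
    · rw [if_neg hy]
      split_ifs <;> simp [hV]
  · refine le_trans (le_of_eq (Finset.sum_eq_zero fun y _ => if_neg ?_)) hε
    rw [deltaDist_eq_zero_of_notMem s.2 hs]
    exact lt_irrefl 0

/-! ### The core and the constrained cores -/

theorem Cn_subset_of_subset {U : Type*} {R : Set (HornRule U)} {Γ Δ : Set U} (h : Γ ⊆ Cn R Δ) :
    Cn R Γ ⊆ Cn R Δ := by
  intro s hs
  induction hs with
  | prem s hs => exact h hs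
  | rule r hr _ ih => exact Derives.rule r hr ih

theorem subset_Cn {U : Type*} (R : Set (HornRule U)) (Γ : Set U) : Γ ⊆ Cn R Γ :=
  fun s hs => Derives.prem s hs

theorem Cn_mono {U : Type*} (R : Set (HornRule U)) : Monotone (Cn R) := fun _ _ h =>
  Cn_subset_of_subset (h.trans (subset_Cn R _))

theorem iterate_T_subset_Cn {U : Type*} (R : Set (HornRule U)) (Γ : Set U) (n : ℕ) :
    (T R)^[n] Γ ⊆ Cn R Γ := by
  rw [Cn_eq_iUnion]
  exact Set.subset_iUnion (fun n => (T R)^[n] Γ) n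

open Classical in
-- Each deletion removes a derivable element, so derivability passes back along the scan by
-- transitivity. The order of the scan plays no role.
theorem foldl_erase_derivable {U : Type*} [DecidableEq U] (R : Set (HornRule U)) (l : List U) (S : Finset U) :
    l.foldl (fun (A : Finset U) s => if s ∈ Cn R ((A : Set U) \ {s}) then A.erase s else A) S ⊆ S ∧
      (S : Set U) ⊆ Cn R
        (l.foldl (fun (A : Finset U) s =>
          if s ∈ Cn R ((A : Set U) \ {s}) then A.erase s else A) S : Finset U) := by
  induction l generalizing S with
  | nil => exact ⟨Finset.Subset.refl _, subset_Cn R _⟩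
  | cons a l ih =>
    simp only [List.foldl_cons]
    by_cases h : a ∈ Cn R ((S : Set U) \ {a})
    · simp only [if_pos h]
      obtain ⟨h1, h2⟩ := ih (S.erase a)
      refine ⟨h1.trans (Finset.erase_subset a S), Set.Subset.trans ?_ (Cn_subset_of_subset h2)⟩
      rw [Finset.coe_erase]
      intro u hu
      by_cases hua : u = a
      · exact hua ▸ h
      · exact subset_Cn R _ ⟨hu, hua⟩
    · simp only [if_neg h]
      exact ih S

theorem atom_subset {U : Type*} [LinearOrder U] (R : Set (HornRule U)) (S : Finset U) :
    atom R S ⊆ S :=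
  (foldl_erase_derivable R _ S).1

theorem subset_Cn_atom {U : Type*} [LinearOrder U] (R : Set (HornRule U)) (S : Finset U) :
    (S : Set U) ⊆ Cn R (atom R S : Set U) :=
  (foldl_erase_derivable R _ S).2

theorem exists_mem_iterate_of_mem_Cn {U : Type*} {R : Set (HornRule U)} {B : Set U} {s : U}
    (h : s ∈ Cn R B) : ∃ n : ℕ, depth R B s = n ∧ s ∈ (T R)^[n] B := by
  rw [Cn_eq_iUnion, Set.mem_iUnion] at h
  obtain ⟨n, hn⟩ := h
  obtain ⟨k, hk, hkd⟩ := csInf_mem (s := (fun n : ℕ => (n : ℕ∞)) '' {n : ℕ | s ∈ (T R)^[n] B})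
    ⟨_, n, hn, rfl⟩
  exact ⟨k, hkd.symm, hk⟩

theorem exists_maxDepth_eq {U : Type*} [LinearOrder U] (R : Set (HornRule U)) (S : Finset U) :
    ∃ D : ℕ, maxDepth R S = D := by
  have : maxDepth R S < ⊤ := by
    refine (Finset.sup_lt_iff (WithTop.coe_lt_top 0)).2 fun q hq => ?_
    obtain ⟨n, hn, -⟩ := exists_mem_iterate_of_mem_Cn (subset_Cn_atom R S hq)
    rw [hn]
    exact WithTop.coe_lt_top n
  obtain ⟨D, hD⟩ := WithTop.ne_top_iff_exists.1 this.ne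
  exact ⟨D, hD.symm⟩

/-- An element outside the core is derived from it within the maximal depth, and the core is
contained in the base without that element. -/
theorem atomDelta_subset_atom {U : Type*} [LinearOrder U] {R : Set (HornRule U)} {S : Finset U}
    {δ : ℕ} (hδ : maxDepth R S ≤ δ) : atomDelta R S δ ⊆ atom R S := by
  intro q hq
  obtain ⟨hqS, hq'⟩ := mem_atomDelta.1 hq
  by_contra hqA
  obtain ⟨n, hn, hqn⟩ := exists_mem_iterate_of_mem_Cn (subset_Cn_atom R S hqS)
  have hnδ : n ≤ δ := by
    have h1 : depth R (atom R S : Set U) q ≤ maxDepth R S :=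
      Finset.le_sup (f := fun q => depth R (atom R S : Set U) q) hqS
    rw [hn] at h1
    exact_mod_cast h1.trans hδ
  refine hq' ((T_mono R).iterate δ ?_ (iterate_T_mono R _ hnδ hqn))
  exact fun a ha => ⟨atom_subset R S ha, fun h => hqA (Set.mem_singleton_iff.1 h ▸ ha)⟩

theorem atomDelta_zero {U : Type*} (R : Set (HornRule U)) (S : Finset U) :
    atomDelta R S 0 = S :=
  Finset.Subset.antisymm (atomDelta_subset R S 0) fun _ hs => mem_atomDelta.2 ⟨hs, fun h => h.2 rfl⟩

theorem closureDist_eq_zero {U : Type*} [Finite U] {R : Set (HornRule U)} {S : Finset U}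
    {s t : U} (h : Cn R (((S : Set U) \ {s}) ∪ {s}) = Cn R (((S : Set U) \ {s}) ∪ {t})) :
    closureDist R S s t = 0 := by
  rw [closureDist, ← h, Set.inter_self, Set.union_self, div_self, sub_self]
  have : 0 < (Cn R (((S : Set U) \ {s}) ∪ {s})).ncard :=
    (Set.ncard_pos (Set.toFinite _)).2 ⟨s, subset_Cn R _ (Or.inr rfl)⟩
  exact_mod_cast this.ne'

/-- A deductively independent core of at least two atoms survives at every delay. -/
theorem atom_subset_atomDelta {U : Type*} [Finite U] [LinearOrder U] {R : Set (HornRule U)}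
    {S Shat : Finset U} (hsub : atom R S ⊆ Shat) (hdis : CoreDisjoint R S Shat)
    (hcard : 1 < (atom R S).card) (δ : ℕ) : atom R S ⊆ atomDelta R S δ := by
  intro a ha
  have haS := atom_subset R S ha
  refine mem_atomDelta.2 ⟨haS, fun hder => ?_⟩
  -- If `a` were derivable from the rest, replacing it by another atom `b` would preserve the
  -- closure. Then `b` would have distortion zero for both atoms, against disjointness.
  obtain ⟨b, hb, hba⟩ := Finset.exists_mem_ne hcard a
  have hbS := atom_subset R S hb
  refine Set.disjoint_left.1 (hdis a ha b hb hba.symm)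
    (show b ∈ _ from ⟨hsub hb, closureDist_eq_zero ?_⟩) ⟨hsub hb, closureDist_eq_zero rfl⟩
  have hab : ((S : Set U) \ {a}) ∪ {b} = (S : Set U) \ {a} :=
    Set.union_eq_left.2 (Set.singleton_subset_iff.2 ⟨hbS, hba⟩)
  rw [hab]
  refine Set.Subset.antisymm (Cn_subset_of_subset ?_) (Cn_mono R Set.subset_union_left)
  rintro u (hu | rfl)
  · exact subset_Cn R _ hu
  · exact iterate_T_subset_Cn R _ δ hder

/-- Under core-disjointness the rate never drops below the rate of the core. -/
theorem subsetRate_atom_le_subsetRate_atomDelta {U : Type*} [Finite U] [LinearOrder U]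
    {R : Set (HornRule U)} {S Shat : Finset U} {P : S → ℝ} (hP : ∀ s, 0 ≤ P s)
    (hsub : atom R S ⊆ Shat) (hdis : CoreDisjoint R S Shat) (δ : ℕ) :
    subsetRate P (atom R S) ≤ subsetRate P (atomDelta R S δ) := by
  by_cases hcard : 1 < (atom R S).card
  · exact subsetRate_mono hP (atom_subset_atomDelta hsub hdis hcard δ)
  -- Disjointness says nothing about a core of at most one atom, but its rate is zero.
  · rw [subsetRate_eq_zero_of_card_le_one hP (not_lt.1 hcard),
      ← subsetRate_eq_zero_of_card_le_one hP (B := ∅) (by simp)]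
    exact subsetRate_mono hP (Finset.empty_subset _)

/-! ### Existence and optimality of the minimum delay -/

theorem minDelay_le_of_subsetRate_atom_le {U X Y : Type*} [LinearOrder U] [Fintype X] [Fintype Y]
    {R : Set (HornRule U)} {S : Finset U} {P : S → ℝ} (hP : ∀ s, 0 ≤ P s) {W : X → Y → ℝ}
    (h : subsetRate P (atom R S) ≤ capacity W) :
    (feasibleDelays R P W).Nonempty ∧ (minDelay R P W : ℕ∞) ≤ maxDepth R S := by
  obtain ⟨D, hD⟩ := exists_maxDepth_eq R S
  have hmem : D ∈ feasibleDelays R P W :=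
    (subsetRate_mono hP (atomDelta_subset_atom hD.le)).trans h
  refine ⟨⟨D, hmem⟩, ?_⟩
  rw [hD]
  exact_mod_cast Nat.sInf_le hmem

theorem reliable_iff {U X Y : Type*} [DecidableEq U] [Fintype X]
    [Fintype Y] {R : Set (HornRule U)} {S Shat : Finset U} {P : S → ℝ}
    (hP : P ∈ stdSimplex ℝ S) {W : X → Y → ℝ} (hW : IsKernel W) (hC : 0 < capacity W) {δ : ℕ}
    (hShat : Shat.Nonempty) (hsub : atomDelta R S δ ⊆ Shat)
    (hdis : DeltaCoreDisjoint R S Shat δ) :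
    ReliableAtDelay R Shat P W δ ↔ subsetRate P (atomDelta R S δ) ≤ capacity W :=
  ⟨subsetRate_le_capacity_of_reliable hP hW hC hdis,
    reliable_of_subsetRate_le_capacity hP hW hC hShat hsub⟩

/-- A feasible delay forces the core rate below capacity, hence the threshold is at most the maximal
depth. So disjointness is available at the threshold and at every smaller delay, where the rate
characterization decides. -/
theorem isLeast_minDelay {U X Y : Type*} [Finite U] [LinearOrder U] [Fintype X] [Fintype Y]
    {R : Set (HornRule U)} {S Shat : Finset U} {P : S → ℝ}
    (hP : P ∈ stdSimplex ℝ S) {W : X → Y → ℝ} (hW : IsKernel W) (hC : 0 < capacity W)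
    (hShat : Shat.Nonempty) (hsub : S ⊆ Shat) (hdis : CoreDisjoint R S Shat)
    (hdisδ : ∀ δ : ℕ, (δ : ℕ∞) ≤ maxDepth R S → DeltaCoreDisjoint R S Shat δ)
    (hne : (feasibleDelays R P W).Nonempty) :
    IsLeast {δ : ℕ | ReliableAtDelay R Shat P W δ} (minDelay R P W) := by
  have hsubδ : ∀ δ, atomDelta R S δ ⊆ Shat := fun δ => (atomDelta_subset R S δ).trans hsub
  have hle : (minDelay R P W : ℕ∞) ≤ maxDepth R S :=
    (minDelay_le_of_subsetRate_atom_le hP.1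
      ((subsetRate_atom_le_subsetRate_atomDelta hP.1 ((atom_subset R S).trans hsub) hdis _).trans
        hne.choose_spec)).2
  refine ⟨(reliable_iff hP hW hC hShat (hsubδ _) (hdisδ _ hle)).2 (Nat.sInf_mem hne),
    fun δ hδ => ?_⟩
  by_contra hlt
  have hδle : (δ : ℕ∞) ≤ maxDepth R S :=
    le_trans (by exact_mod_cast (not_le.1 hlt).le) hle
  exact hlt (Nat.sInf_le ((reliable_iff hP hW hC hShat (hsubδ _) (hdisδ _ hδle)).1 hδ))

end SemComm

theorem mainTheorem7 {X Y : Type*} [Fintype X] [Fintype Y] (W : X → Y → ℝ)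
    (hW : SemComm.IsKernel W) (hC : 0 < SemComm.capacity W) :
    -- the threshold `K ε η` depends on the channel, on `ε` and on `η` only
    ∃ K : ℝ → ℝ → ℕ,
      ∀ (U : Type*) [Fintype U] [LinearOrder U] (R : Set (SemComm.HornRule U))
        (S Shat : Finset U) (P : S → ℝ),
        P ∈ stdSimplex ℝ S → Shat.Nonempty →
        -- `P_δ H(π_δ) ≤ C(W)` characterizes the delays at which communication is possible
        (∀ δ : ℕ, SemComm.atomDelta R S δ ⊆ Shat → SemComm.DeltaCoreDisjoint R S Shat δ →
          (SemComm.ReliableAtDelay R Shat P W δ ↔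
            SemComm.subsetRate P (SemComm.atomDelta R S δ) ≤ SemComm.capacity W)) ∧
        -- `δ*` is the minimum derivation delay
        (S ⊆ Shat → SemComm.CoreDisjoint R S Shat →
          (∀ δ : ℕ, (δ : ℕ∞) ≤ SemComm.maxDepth R S → SemComm.DeltaCoreDisjoint R S Shat δ) →
          (SemComm.feasibleDelays R P W).Nonempty →
          IsLeast {δ : ℕ | SemComm.ReliableAtDelay R Shat P W δ} (SemComm.minDelay R P W)) ∧
        -- (i)
        (SemComm.entropy P ≤ SemComm.capacity W →
          (SemComm.feasibleDelays R P W).Nonempty ∧ SemComm.minDelay R P W = 0 ∧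
          (S ⊆ Shat → SemComm.ReliableAtDelay R Shat P W 0)) ∧
        -- (ii)
        (SemComm.atom R S ⊆ Shat → SemComm.CoreDisjoint R S Shat →
          SemComm.capacity W < SemComm.subsetRate P (SemComm.atom R S) →
          SemComm.feasibleDelays R P W = ∅ ∧
          ∀ δ : ℕ, SemComm.atomDelta R S δ ⊆ Shat → SemComm.DeltaCoreDisjoint R S Shat δ →
            ¬ SemComm.ReliableAtDelay R Shat P W δ) ∧
        -- (iii)
        (SemComm.capacity W < SemComm.entropy P →
          SemComm.subsetRate P (SemComm.atom R S) ≤ SemComm.capacity W →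
          (SemComm.feasibleDelays R P W).Nonempty ∧
          1 ≤ SemComm.minDelay R P W ∧
          (SemComm.minDelay R P W : ℕ∞) ≤ SemComm.maxDepth R S ∧
          (SemComm.atomDelta R S (SemComm.minDelay R P W) ⊆ Shat →
            SemComm.DeltaCoreDisjoint R S Shat (SemComm.minDelay R P W) →
            ∀ ε : ℝ, 0 < ε → ε < 1 →
              ∃ nStar : ℕ,
                IsLeast (SemComm.blocklengths R S Shat W (SemComm.minDelay R P W) ε) nStar ∧
                ((1 - ε) *
                    Real.logb 2 ((SemComm.atomDelta R S (SemComm.minDelay R P W)).card : ℝ) - 1) /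
                  SemComm.capacity W ≤ (nStar : ℝ) ∧
                ∀ η : ℝ, 0 < η →
                  K ε η ≤ (SemComm.atomDelta R S (SemComm.minDelay R P W)).card →
                  (nStar : ℝ) ≤ (1 + η) *
                    (Real.logb 2 ((SemComm.atomDelta R S (SemComm.minDelay R P W)).card : ℝ) /
                      SemComm.capacity W))) := by
  -- The threshold is fixed before any knowledge base is given; it is a dummy outside positive `ε`
  -- and `η`.
  have hK : ∀ ε η : ℝ, ∃ K : ℕ, 0 < ε → 0 < η → ∀ M ≥ K, ∃ n : ℕ,
      (n : ℝ) ≤ (1 + η) * (Real.logb 2 M / SemComm.capacity W) ∧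
      ∃ (c : ℕ → Fin n → X) (g : (Fin n → Y) → ℕ),
        ∀ j < M, ∑ y, (if g y = j then 0 else SemComm.memoryless W (c j) y) ≤ ε := by
    intro ε η
    by_cases h : 0 < ε ∧ 0 < η
    · obtain ⟨K, hK⟩ := SemComm.exists_short_code hW hC h.1 h.2
      exact ⟨K, fun _ _ => hK⟩
    · exact ⟨0, fun h1 h2 => absurd ⟨h1, h2⟩ h⟩
  choose K hK using hK
  refine ⟨K, fun U _ _ R S Shat P hP hShat => ⟨fun δ hsub hdis =>
    SemComm.reliable_iff hP hW hC hShat hsub hdis,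
    SemComm.isLeast_minDelay hP hW hC hShat, fun hent => ?_, fun hsub hdis hlt => ?_,
    fun hent hle => ?_⟩⟩
  · have h0 : (0 : ℕ) ∈ SemComm.feasibleDelays R P W := by
      change SemComm.subsetRate P (SemComm.atomDelta R S 0) ≤ _
      rwa [SemComm.atomDelta_zero, SemComm.subsetRate_self hP]
    refine ⟨⟨0, h0⟩, Nat.le_zero.1 (Nat.sInf_le h0), fun hsub => ?_⟩
    exact SemComm.reliable_of_subsetRate_le_capacity hP hW hC hShat
      ((SemComm.atomDelta_zero R S).subset.trans hsub) h0
  · have hrate : ∀ δ, SemComm.capacity W < SemComm.subsetRate P (SemComm.atomDelta R S δ) :=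
      fun δ => hlt.trans_le
        (SemComm.subsetRate_atom_le_subsetRate_atomDelta hP.1 hsub hdis δ)
    refine ⟨Set.eq_empty_of_forall_notMem fun δ hδ => (hrate δ).not_ge hδ, fun δ _ hdisδ hrel => ?_⟩
    exact (hrate δ).not_ge (SemComm.subsetRate_le_capacity_of_reliable hP hW hC hdisδ hrel)
  · obtain ⟨hne, hmin⟩ := SemComm.minDelay_le_of_subsetRate_atom_le (R := R) hP.1 hle
    refine ⟨hne, ?_, hmin, fun hsub hdis ε hε0 hε1 => ?_⟩
    · rw [Nat.one_le_iff_ne_zero]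
      intro h0
      have hmem : SemComm.subsetRate P (SemComm.atomDelta R S (SemComm.minDelay R P W)) ≤
        SemComm.capacity W := Nat.sInf_mem hne
      rw [h0, SemComm.atomDelta_zero, SemComm.subsetRate_self hP] at hmem
      exact hent.not_ge hmem
    · have hS : S.Nonempty := by
        rw [Finset.nonempty_iff_ne_empty]
        rintro rfl
        simpa using hP.2
      set δ := SemComm.minDelay R P W
      -- The core may be smaller than the threshold, so a code for at least `K ε 1` messages is
      -- used, part of them idle.
      have hbl : (SemComm.blocklengths R S Shat W δ ε).Nonempty := by
        obtain ⟨n, -, c, g, hcg⟩ := hK ε 1 hε0 one_pos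
          (max (K ε 1) (SemComm.atomDelta R S δ).card) (le_max_left _ _)
        exact ⟨n, SemComm.mem_blocklengths_of_code hS hShat hW hsub hε0.le (le_max_right _ _)
          c g hcg⟩
      refine ⟨_, ⟨Nat.sInf_mem hbl, fun n hn => Nat.sInf_le hn⟩, ?_, fun η hη hKle => ?_⟩
      · rw [div_le_iff₀ hC]
        exact SemComm.logb_card_le_of_mem_blocklengths hW hC hdis (Nat.sInf_mem hbl)
      · obtain ⟨n, hn, c, g, hcg⟩ := hK ε η hε0 hη _ hKle
        refine le_trans ?_ hn
        exact_mod_cast Nat.sInf_le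
          (SemComm.mem_blocklengths_of_code hS hShat hW hsub hε0.le le_rfl c g hcg)
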